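/- Let $\mathbb F$ be an algebraically closed field of characteristic $0$ and let $\mathbf i\in\mathbb F$ with $\mathbf i^2=-1$. An evolution algebra is a finite-dimensional algebra $\mathbb A$ (a vector space with a bilinear product) that has a natural basis $e_1,\dots,e_n$, i.e. one with $e_je_l=0$ for $j\ne l$; its structure matrix is $(w_{kj})$, where $e_j^2=\sum_k w_{kj}e_k$. It is non-degenerate if $\{x: x\mathbb A+\mathbb Ax=0\}=0$. A non-degenerate evolution algebra has a decomposition $\mathbb A=\mathbb E_1\oplus\dots\oplus\mathbb E_r$, unique up to order, into subspaces each spanned by part of a natural basis, with $\dim\mathbb E_k^2=1$ and, for $k\neq l$, $\mathbb E_k\mathbb E_l=0$ and $\dim(\mathbb E_k^2+\mathbb E_l^2)=2$. The $\delta$-index $\delta(\mathbb A)$ is the decreasing sequence of the dimensions of the $\mathbb E_k$. Multiplying in $\mathbb A$ and projecting onto $\mathbb E_k$ makes $\mathbb E_k$ an algebra, which is isomorphic to exactly one of $\mathbf O_n$ (zero product), $\mathbf E_n$ ($e_j^2=e_1$ for all $j$), $\mathbf I_n$ ($n\ge2$, $e_j^2=e_1+\mathbf i e_2$ for all $j$),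 where $n=\dim\mathbb E_k$. The $\Delta$-trace $\Delta(\mathbb A)$ is the sequence of these types, in decreasing order of dimension and, in equal dimension, in the order $\mathbf O,\mathbf E,\mathbf I$. Consider the following list of algebras with basis $e_1,e_2,e_3$, given by structure matrices (rows separated by semicolons). The parameters are arbitrary in $\mathbb F$, subject only to the condition that the algebra is non-degenerate and has the $\delta$-index under which it is listed (and $\alpha\ne0$ in $\mathbf B_{3,13}^\alpha$). $\delta=(1,1,1)$: - $\Delta=(\mathbf O_1,\mathbf O_1,\mathbf O_1)$: $\mathbf A_{3,1}^{\alpha,\beta,\gamma}=(0,1,\alpha;\ \beta,0,1;\ 1,\gamma,0)$, $\mathbf A_{3,2}^{\alpha}=(0,0,0;\ \alpha,0,1;\ 1,1,0)$. - $\Delta=(\mathbf O_1,\mathbf O_1,\mathbf E_1)$: $\mathbf A_{3,3}^{\alpha,\beta,\gamma,\epsilon}=(0,\alpha,\beta;\ \gamma,0,\epsilon;\ 1,1,1)$, $\mathbf A_{3,4}^{\alpha,\beta,\gamma}=(0,\alpha,\beta;\ 1,0,\gamma;\ 0,1,1)$, $\mathbf A_{3,5}^{\alpha,\beta}=(0,1,\alpha;\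 1,0,\beta;\ 0,0,1)$. - $\Delta=(\mathbf O_1,\mathbf E_1,\mathbf E_1)$: $\mathbf A_{3,6}^{\alpha,\beta,\gamma,\epsilon,\zeta}=(0,\alpha,\beta;\ 1,1,\gamma;\ \epsilon,\zeta,1)$. - $\Delta=(\mathbf E_1,\mathbf E_1,\mathbf E_1)$: $\mathbf A_{3,7}^{\alpha,\beta,\gamma,\epsilon,\zeta,\xi}=(1,\alpha,\beta;\ \gamma,1,\epsilon;\ \zeta,\xi,1)$. $\delta=(2,1)$: - $\Delta=(\mathbf O_2,\mathbf O_1)$: $\mathbf B_{3,1}=(0,0,0;\ 0,0,1;\ 1,1,0)$, $\mathbf B_{3,2}=(0,0,1;\ 0,0,\mathbf i;\ 1,1,0)$. - $\Delta=(\mathbf O_2,\mathbf E_1)$: $\mathbf B_{3,3}^{\alpha}=(0,0,0;\ 0,0,1;\ \alpha,\alpha,1)$, $\mathbf B_{3,4}=(0,0,1;\ 0,0,\mathbf i;\ 1,1,1)$. - $\Delta=(\mathbf E_2,\mathbf O_1)$: $\mathbf B_{3,5}^{\alpha,\beta}=(1,1,\alpha;\ 0,0,\beta;\ 1,1,0)$,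 $\mathbf B_{3,6}^{\alpha}=(1,1,\alpha;\ 0,0,1;\ 0,0,0)$. - $\Delta=(\mathbf E_2,\mathbf E_1)$: $\mathbf B_{3,7}^{\alpha,\beta,\gamma}=(1,1,\beta;\ 0,0,\gamma;\ \alpha,\alpha,1)$. - $\Delta=(\mathbf I_2,\mathbf O_1)$: $\mathbf B_{3,8}^{\alpha}=(1,1,\alpha;\ \mathbf i,\mathbf i,0;\ 1,1,0)$, $\mathbf B_{3,9}^{\pm}=(1,1,1;\ \mathbf i,\mathbf i,\pm\mathbf i;\ 1,1,0)$, $\mathbf B_{3,10}=(1,1,1;\ \mathbf i,\mathbf i,0;\ 0,0,0)$, $\mathbf B_{3,11}=(1,1,1;\ \mathbf i,\mathbf i,-\mathbf i;\ 0,0,0)$. - $\Delta=(\mathbf I_2,\mathbf E_1)$: $\mathbf B_{3,12}^{\alpha,\beta}=(1,1,\alpha;\ \mathbf i,\mathbf i,\beta;\ 1,1,1)$, $\mathbf B_{3,13}^{\alpha}=(1,1,\alpha;\ \mathbf i,\mathbf i,0;\ 0,0,1)$, $\mathbf B_{3,14}=(1,1,1;\ \mathbf i,\mathbf i,\mathbf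 i;\ 0,0,1)$, $\mathbf B_{3,15}^{\alpha}=(1,1,\alpha;\ \mathbf i,\mathbf i,-\alpha\mathbf i;\ 0,0,1)$. $\delta=(3)$: $\mathbf E_3$ with $\Delta=(\mathbf E_3)$, and $\mathbf I_3$ with $\Delta=(\mathbf I_3)$. Theorem. (1) Every $3$-dimensional non-degenerate evolution algebra $\mathbb A$ over $\mathbb F$ has exactly one $\delta$-index and exactly one $\Delta$-trace, and is isomorphic to an algebra of the list standing under $\delta(\mathbb A)$ and $\Delta(\mathbb A)$. This algebra is unique up to the coincidences in (3). (2) Each algebra of the list has the $\Delta$-trace under which it is listed. (3) Two different algebras of the list are isomorphic if and only if they are $\mathbf B_{3,5}^{\alpha,\beta}$ and $\mathbf B_{3,5}^{\alpha,-\beta}$, or $\mathbf B_{3,6}^{\alpha}$ and $\mathbf B_{3,6}^{-\alpha}$, or $\mathbf B_{3,7}^{\alpha,\beta,\gamma}$ and $\mathbf B_{3,7}^{\alpha,\beta,-\gamma}$, or two members of the same family $\mathbf A_{3,l}$ that are related by a permutation of the basis elements up to rescaling: with structure matrices $M,M'$, there are a permutation $\sigma$ of $\{1,2,3\}$ and scalars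 $x_j\ne0$, with $x_j=1$ whenever $M_{jj}=1$, such that $x_kM_{kj}=x_j^2M'_{\sigma(k)\sigma(j)}$ for all $k,j$. Moreover, every isomorphism between two algebras listed under $\delta=(1,1,1)$ is of the form $e_j\mapsto x_je'_{\sigma(j)}$ with such $\sigma$ and $x_j$. -/

import Mathlib

/-!
Algebras are vector spaces `V` over a field `F` with a bilinear product
`μ : V →ₗ[F] V →ₗ[F] V`; for a Mathlib algebra `A` the product is `LinearMap.mul F A`.
-/

namespace EvolutionAlgebra

section General

variable {F V W : Type*} [Field F] [AddCommGroup V] [Module F V] [AddCommGroup W] [Module F W]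

/-- A linear equivalence that respects the products: an isomorphism of algebras. -/
def IsAlgIso (μ : V →ₗ[F] V →ₗ[F] V) (ν : W →ₗ[F] W →ₗ[F] W) (φ : V ≃ₗ[F] W) : Prop :=
  ∀ x y, φ (μ x y) = ν (φ x) (φ y)

/-- Two algebras are isomorphic. -/
def Isomorphic (μ : V →ₗ[F] V →ₗ[F] V) (ν : W →ₗ[F] W →ₗ[F] W) : Prop :=
  ∃ φ : V ≃ₗ[F] W, IsAlgIso μ ν φ

/-- A natural basis: distinct basis vectors have product zero. -/
def IsNaturalBasis (μ : V →ₗ[F] V →ₗ[F] V) {ι : Type*} (b : Module.Basis ι F V) : Prop :=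
  ∀ k l, k ≠ l → μ (b k) (b l) = 0

/-- A (finite-dimensional) evolution algebra: an algebra that has a natural basis. -/
def IsEvolutionAlgebra (μ : V →ₗ[F] V →ₗ[F] V) : Prop :=
  ∃ b : Module.Basis (Fin (Module.finrank F V)) F V, IsNaturalBasis μ b

/-- Non-degenerate: the annihilator `{x | x V + V x = 0}` is zero. -/
def IsNondegenerate (μ : V →ₗ[F] V →ₗ[F] V) : Prop :=
  ∀ x, (∀ y, μ x y = 0 ∧ μ y x = 0) → x = 0

/-- An extending evolution subspace: the span of a subset of some natural basis. -/
def IsExtendingSubspace (μ : V →ₗ[F] V →ₗ[F] V) (U : Submodule F V) : Prop :=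
  ∃ b : Module.Basis (Fin (Module.finrank F V)) F V, IsNaturalBasis μ b ∧
    ∃ s : Set (Fin (Module.finrank F V)), U = Submodule.span F (b '' s)

/-- The standard extending evolution subspaces decomposition (of an algebra with zero
annihilator); `Submodule.map₂ μ U U` is the span `U²` of the products of elements of `U`. -/
structure IsStandardDecomposition (μ : V →ₗ[F] V →ₗ[F] V) {r : ℕ}
    (U : Fin r → Submodule F V) : Prop where
  isInternal : DirectSum.IsInternal U
  extending : ∀ k, IsExtendingSubspace μ (U k)
  finrank_sq : ∀ k, Module.finrank F (Submodule.map₂ μ (U k) (U k)) = 1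
  mul_eq_zero : ∀ k l, k ≠ l → ∀ x ∈ U k, ∀ y ∈ U l, μ x y = 0
  finrank_sq_sup : ∀ k l, k ≠ l → Module.finrank F
    ↥(Submodule.map₂ μ (U k) (U k) ⊔ Submodule.map₂ μ (U l) (U l)) = 2

/-- The `δ`-index of the non-degenerate evolution algebra `μ` is `d`: the dimensions of the
components of the standard decomposition, in decreasing order. -/
def HasDeltaIndex (μ : V →ₗ[F] V →ₗ[F] V) (d : List ℕ) : Prop :=
  IsEvolutionAlgebra μ ∧ IsNondegenerate μ ∧
    ∃ (r : ℕ) (U : Fin r → Submodule F V), IsStandardDecomposition μ U ∧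
      d = List.ofFn (fun k => Module.finrank F (U k)) ∧ d.Pairwise (· ≥ ·)

/-- The projection of an internal direct sum onto one component. -/
noncomputable def componentProj {r : ℕ} {U : Fin r → Submodule F V}
    (h : DirectSum.IsInternal U) (k : Fin r) : V →ₗ[F] U k :=
  DirectSum.component F (Fin r) (fun l => U l) k ∘ₗ
    (LinearEquiv.ofBijective (DirectSum.coeLinearMap U) h).symm.toLinearMap

/-- The algebra associated to a component `U k`: the product on `U k` given by multiplying in the
whole algebra and projecting onto `U k`. -/
noncomputable def associatedProduct (μ : V →ₗ[F] V →ₗ[F] V) {r : ℕ} {U : Fin r → Submodule F V}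
    (h : DirectSum.IsInternal U) (k : Fin r) : U k →ₗ[F] U k →ₗ[F] U k :=
  (μ.domRestrict₁₂ (U k) (U k)).compr₂ (componentProj h k)

/-- The evolution algebra on `Fⁿ` with structure matrix `M`: its product satisfies
`e_j e_j = ∑ k, M k j • e_k` and `e_j e_l = 0` for `j ≠ l`. -/
def ofMatrix {n : ℕ} (M : Matrix (Fin n) (Fin n) F) :
    (Fin n → F) →ₗ[F] (Fin n → F) →ₗ[F] (Fin n → F) :=
  LinearMap.mk₂ F (fun x y => M.mulVec (x * y))
    (fun x x' y => by rw [add_mul, Matrix.mulVec_add])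
    (fun c x y => by rw [smul_mul_assoc, Matrix.mulVec_smul])
    (fun x y y' => by rw [mul_add, Matrix.mulVec_add])
    (fun c x y => by rw [mul_smul_comm, Matrix.mulVec_smul])

end General

/-- The three kinds `O`, `E`, `I` of blocks. -/
inductive Kind
  | O
  | E
  | I

/-- The position of a kind in the order `O`, `E`, `I`. -/
def Kind.rank : Kind → ℕ
  | .O => 0
  | .E => 1
  | .I => 2

/-- The symbol `O_n`, `E_n` or `I_n`. -/
structure Block where
  kind : Kind
  dim : ℕ

/-- `I_n` is only used for `n ≥ 2`. -/
def Block.Valid (B : Block) : Prop := B.kind = Kind.I → 2 ≤ B.dim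

/-- Larger dimension first; in the same dimension `O` before `E` before `I`. -/
def Block.Ge (B C : Block) : Prop :=
  C.dim < B.dim ∨ (B.dim = C.dim ∧ B.kind.rank ≤ C.kind.rank)

section Lists

variable {F V : Type*} [Field F] [AddCommGroup V] [Module F V]

/-- The structure matrices of `O_n` (zero product), `E_n` (`e_j² = e_1` for all `j`) and
`I_n` (`e_j² = e_1 + i e_2` for all `j`), where `i` is a square root of `-1`. -/
def Block.matrix (i : F) (B : Block) : Matrix (Fin B.dim) (Fin B.dim) F :=
  match B.kind with
  | .O => 0
  | .E => Matrix.of fun k _ => if k.val = 0 then 1 else 0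
  | .I => Matrix.of fun k _ => if k.val = 0 then 1 else if k.val = 1 then i else 0

/-- The `Δ`-trace of the non-degenerate evolution algebra `μ` is `t`: the isomorphism types, in
decreasing order, of the algebras associated to the components of the standard decomposition. -/
def HasDeltaTrace (i : F) (μ : V →ₗ[F] V →ₗ[F] V) (t : List Block) : Prop :=
  IsEvolutionAlgebra μ ∧ IsNondegenerate μ ∧
    ∃ (r : ℕ) (U : Fin r → Submodule F V) (h : IsStandardDecomposition μ U) (T : Fin r → Block),
      (∀ k, (T k).Valid ∧
        Isomorphic (associatedProduct μ h.isInternal k) (ofMatrix ((T k).matrix i))) ∧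
      t = List.ofFn T ∧ t.Pairwise Block.Ge

/-- The names of the algebras in the list. -/
inductive Entry (F : Type*)
  | A1 (α β γ : F)
  | A2 (α : F)
  | A3 (α β γ ε : F)
  | A4 (α β γ : F)
  | A5 (α β : F)
  | A6 (α β γ ε ζ : F)
  | A7 (α β γ ε ζ ξ : F)
  | B1
  | B2
  | B3 (α : F)
  | B4
  | B5 (α β : F)
  | B6 (α : F)
  | B7 (α β γ : F)
  | B8 (α : F)
  | B9plus
  | B9minus
  | B10
  | B11
  | B12 (α β : F)
  | B13 (α : F)
  | B14
  | B15 (α : F)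
  | E3
  | I3

namespace Entry

/-- The structure matrices of the algebras in the list. -/
def matrix (i : F) : Entry F → Matrix (Fin 3) (Fin 3) F
  | A1 α β γ => !![0, 1, α; β, 0, 1; 1, γ, 0]
  | A2 α => !![0, 0, 0; α, 0, 1; 1, 1, 0]
  | A3 α β γ ε => !![0, α, β; γ, 0, ε; 1, 1, 1]
  | A4 α β γ => !![0, α, β; 1, 0, γ; 0, 1, 1]
  | A5 α β => !![0, 1, α; 1, 0, β; 0, 0, 1]
  | A6 α β γ ε ζ => !![0, α, β; 1, 1, γ; ε, ζ, 1]
  | A7 α β γ ε ζ ξ => !![1, α, β; γ, 1, ε; ζ, ξ, 1]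
  | B1 => !![0, 0, 0; 0, 0, 1; 1, 1, 0]
  | B2 => !![0, 0, 1; 0, 0, i; 1, 1, 0]
  | B3 α => !![0, 0, 0; 0, 0, 1; α, α, 1]
  | B4 => !![0, 0, 1; 0, 0, i; 1, 1, 1]
  | B5 α β => !![1, 1, α; 0, 0, β; 1, 1, 0]
  | B6 α => !![1, 1, α; 0, 0, 1; 0, 0, 0]
  | B7 α β γ => !![1, 1, β; 0, 0, γ; α, α, 1]
  | B8 α => !![1, 1, α; i, i, 0; 1, 1, 0]
  | B9plus => !![1, 1, 1; i, i, i; 1, 1, 0]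
  | B9minus => !![1, 1, 1; i, i, -i; 1, 1, 0]
  | B10 => !![1, 1, 1; i, i, 0; 0, 0, 0]
  | B11 => !![1, 1, 1; i, i, -i; 0, 0, 0]
  | B12 α β => !![1, 1, α; i, i, β; 1, 1, 1]
  | B13 α => !![1, 1, α; i, i, 0; 0, 0, 1]
  | B14 => !![1, 1, 1; i, i, i; 0, 0, 1]
  | B15 α => !![1, 1, α; i, i, -(α * i); 0, 0, 1]
  | E3 => !![1, 1, 1; 0, 0, 0; 0, 0, 0]
  | I3 => !![1, 1, 1; i, i, i; 0, 0, 0]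

/-- The algebra on `F³` with the given name. -/
def product (i : F) (m : Entry F) : (Fin 3 → F) →ₗ[F] (Fin 3 → F) →ₗ[F] (Fin 3 → F) :=
  ofMatrix (m.matrix i)

/-- The `Δ`-trace under which an algebra is listed. -/
def trace : Entry F → List Block
  | A1 _ _ _ | A2 _ => [⟨.O, 1⟩, ⟨.O, 1⟩, ⟨.O, 1⟩]
  | A3 _ _ _ _ | A4 _ _ _ | A5 _ _ => [⟨.O, 1⟩, ⟨.O, 1⟩, ⟨.E, 1⟩]
  | A6 _ _ _ _ _ => [⟨.O, 1⟩, ⟨.E, 1⟩, ⟨.E, 1⟩]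
  | A7 _ _ _ _ _ _ => [⟨.E, 1⟩, ⟨.E, 1⟩, ⟨.E, 1⟩]
  | B1 | B2 => [⟨.O, 2⟩, ⟨.O, 1⟩]
  | B3 _ | B4 => [⟨.O, 2⟩, ⟨.E, 1⟩]
  | B5 _ _ | B6 _ => [⟨.E, 2⟩, ⟨.O, 1⟩]
  | B7 _ _ _ => [⟨.E, 2⟩, ⟨.E, 1⟩]
  | B8 _ | B9plus | B9minus | B10 | B11 => [⟨.I, 2⟩, ⟨.O, 1⟩]
  | B12 _ _ | B13 _ | B14 | B15 _ => [⟨.I, 2⟩, ⟨.E, 1⟩]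
  | E3 => [⟨.E, 3⟩]
  | I3 => [⟨.I, 3⟩]

/-- The `δ`-index under which an algebra is listed. -/
def delta : Entry F → List ℕ
  | A1 _ _ _ | A2 _ | A3 _ _ _ _ | A4 _ _ _ | A5 _ _ | A6 _ _ _ _ _ | A7 _ _ _ _ _ _ => [1, 1, 1]
  | B1 | B2 | B3 _ | B4 | B5 _ _ | B6 _ | B7 _ _ _ | B8 _ | B9plus | B9minus | B10 | B11
  | B12 _ _ | B13 _ | B14 | B15 _ => [2, 1]
  | E3 | I3 => [3]

/-- The extra condition `α ≠ 0` in the family `B13`. -/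
def SideCondition : Entry F → Prop
  | B13 α => α ≠ 0
  | _ => True

/-- The list consists of the named algebras that are non-degenerate and have the `δ`-index of
their family, with `α ≠ 0` in the family `B13`. -/
def Admissible (i : F) (m : Entry F) : Prop :=
  HasDeltaIndex (m.product i) m.delta ∧ m.SideCondition

end Entry

/-- The algebras with structure matrices `M` and `M'` are isomorphic through a permutation of the
basis vectors up to non-zero scalars. The last equation says that the linear bijection
`e_j ↦ x_j e'_{σ j}` respects the products; vectors with `M j j = 1` are not rescaled. -/
def PermutationRelated (M M' : Matrix (Fin 3) (Fin 3) F) : Prop :=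
  ∃ (σ : Equiv.Perm (Fin 3)) (x : Fin 3 → F), (∀ j, x j ≠ 0) ∧ (∀ j, M j j = 1 → x j = 1) ∧
    ∀ k j, x k * M k j = x j ^ 2 * M' (σ k) (σ j)

open Entry in
/-- The coincidences inside the list. -/
inductive Coincide (i : F) : Entry F → Entry F → Prop
  | refl (m : Entry F) : Coincide i m m
  | A1 (α β γ α' β' γ' : F) :
      PermutationRelated ((A1 α β γ).matrix i) ((A1 α' β' γ').matrix i) →
      Coincide i (A1 α β γ) (A1 α' β' γ')
  | A2 (α α' : F) :
      PermutationRelated ((A2 α).matrix i) ((A2 α').matrix i) → Coincide i (A2 α) (A2 α')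
  | A3 (α β γ ε α' β' γ' ε' : F) :
      PermutationRelated ((A3 α β γ ε).matrix i) ((A3 α' β' γ' ε').matrix i) →
      Coincide i (A3 α β γ ε) (A3 α' β' γ' ε')
  | A4 (α β γ α' β' γ' : F) :
      PermutationRelated ((A4 α β γ).matrix i) ((A4 α' β' γ').matrix i) →
      Coincide i (A4 α β γ) (A4 α' β' γ')
  | A5 (α β α' β' : F) :
      PermutationRelated ((A5 α β).matrix i) ((A5 α' β').matrix i) →
      Coincide i (A5 α β) (A5 α' β')
  | A6 (α β γ ε ζ α' β' γ' ε' ζ' : F) :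
      PermutationRelated ((A6 α β γ ε ζ).matrix i) ((A6 α' β' γ' ε' ζ').matrix i) →
      Coincide i (A6 α β γ ε ζ) (A6 α' β' γ' ε' ζ')
  | A7 (α β γ ε ζ ξ α' β' γ' ε' ζ' ξ' : F) :
      PermutationRelated ((A7 α β γ ε ζ ξ).matrix i) ((A7 α' β' γ' ε' ζ' ξ').matrix i) →
      Coincide i (A7 α β γ ε ζ ξ) (A7 α' β' γ' ε' ζ' ξ')
  | B5 (α β : F) : Coincide i (B5 α β) (B5 α (-β))
  | B6 (α : F) : Coincide i (B6 α) (B6 (-α))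
  | B7 (α β γ : F) : Coincide i (B7 α β γ) (B7 α β (-γ))

end Lists

end EvolutionAlgebra

open EvolutionAlgebra

namespace EvolutionAlgebra

/-! ### Uniqueness of the standard decomposition. -/

section Structure

variable {F V W X : Type*} [Field F] [AddCommGroup V] [Module F V] [AddCommGroup W] [Module F W]
  [AddCommGroup X] [Module F X]

/-! The decomposition is intrinsic. If `x ≠ 0` and all multiples of `x` lie on one line, that line
is the square of a component, and the component consists of all elements whose multiples lie on it
(`mem_iff`, `exists_sq_eq`). Hence two standard decompositions agree up to order, isomorphisms carry
one to the other, and index and trace are invariants. Block types are told apart because `O_n` has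
zero product, while `(x²)² = 0` holds identically in `I_n` but fails in `E_n`.

For a structure matrix the components collect the basis vectors with proportional columns. In
dimension 3, after permuting and rescaling, the columns are pairwise independent, or the first two
are equal and independent of the third, or all are equal.

Index `(1,1,1)`: all multiples of `φ e_j` lie on the line of `φ (e_j²)`. Since the squares in the
target are pairwise independent, `φ e_j` has only one nonzero coordinate, so isomorphisms are
monomial (`IsAlgIso.exists_perm`). Classification is then a matter of the zero pattern and of
scaling entries to 1 by extracting roots; zero patterns also separate the families.

Index `(2,1)`: the product is `(x₁y₁ + x₂y₂) v + x₃y₃ w` with `v`, `w` independent, so an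
isomorphism is a similitude of the plane together with a scaling of `e₃` (`rel_or_of_isAlgIso`). In
the coordinates `x₁ ± i x₂`, `x₃` it is diagonal, up to exchanging the first two. Only a torus and a
swap then act on the six coordinates `(P, Q, a)` of `v` and `(R, S, b)` of `w`, and the families are
normal forms for this action. The block type of the plane is `O`, `I` or `E` according to whether
both, one or none of `P`, `Q` vanish; that of `e₃` is decided by `b`.

Index `(3)`: the product is `(x · y) v`. Reflections are orthogonal and move `v`, after scaling, to
`e₁` if `v · v ≠ 0`, and to `e₁ + i e₂` if `v` is isotropic. -/

theorem Isomorphic.refl (μ : V →ₗ[F] V →ₗ[F] V) : Isomorphic μ μ :=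
  ⟨LinearEquiv.refl F V, fun _ _ => rfl⟩

theorem IsAlgIso.symm {μ : V →ₗ[F] V →ₗ[F] V} {ν : W →ₗ[F] W →ₗ[F] W} {φ : V ≃ₗ[F] W}
    (h : IsAlgIso μ ν φ) : IsAlgIso ν μ φ.symm := fun x y => by
  rw [LinearEquiv.symm_apply_eq, h]; simp

theorem Isomorphic.symm {μ : V →ₗ[F] V →ₗ[F] V} {ν : W →ₗ[F] W →ₗ[F] W}
    (h : Isomorphic μ ν) : Isomorphic ν μ :=
  h.imp' LinearEquiv.symm fun _ h => h.symm

theorem Isomorphic.trans {μ : V →ₗ[F] V →ₗ[F] V} {ν : W →ₗ[F] W →ₗ[F] W}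
    {ρ : X →ₗ[F] X →ₗ[F] X} (h : Isomorphic μ ν) (h' : Isomorphic ν ρ) : Isomorphic μ ρ := by
  obtain ⟨φ, hφ⟩ := h
  obtain ⟨ψ, hψ⟩ := h'
  exact ⟨φ.trans ψ, fun x y => by simp [hφ x y, hψ (φ x) (φ y)]⟩

theorem IsEvolutionAlgebra.comm {μ : V →ₗ[F] V →ₗ[F] V} (h : IsEvolutionAlgebra μ) (x y : V) :
    μ x y = μ y x := by
  obtain ⟨b, hb⟩ := h
  have : μ = μ.flip := b.ext fun k => b.ext fun l => by
    by_cases hkl : k = l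
    · subst hkl; rfl
    · simp [hb k l hkl, hb l k (Ne.symm hkl)]
  exact LinearMap.congr_fun₂ this x y

section Projection

variable {r : ℕ} {U : Fin r → Submodule F V} (h : DirectSum.IsInternal U)

theorem componentProj_of_mem {k : Fin r} {x : V} (hx : x ∈ U k) :
    componentProj h k x = ⟨x, hx⟩ := by
  have : (LinearEquiv.ofBijective (DirectSum.coeLinearMap U) h).symm x
      = DirectSum.lof F (Fin r) (fun l => U l) k ⟨x, hx⟩ := by
    rw [LinearEquiv.symm_apply_eq]
    exact (DirectSum.coeLinearMap_lof U k ⟨x, hx⟩).symm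
  simp [componentProj, this]

theorem componentProj_of_mem_ne {k l : Fin r} (hkl : l ≠ k) {x : V} (hx : x ∈ U l) :
    componentProj h k x = 0 := by
  have : (LinearEquiv.ofBijective (DirectSum.coeLinearMap U) h).symm x
      = DirectSum.lof F (Fin r) (fun l => U l) l ⟨x, hx⟩ := by
    rw [LinearEquiv.symm_apply_eq]
    exact (DirectSum.coeLinearMap_lof U l ⟨x, hx⟩).symm
  simp [componentProj, this, DirectSum.component.of, hkl]

theorem linearMap_ext_of_isInternal {f g : V →ₗ[F] W} (h : DirectSum.IsInternal U)
    (hfg : ∀ k, ∀ x ∈ U k, f x = g x) : f = g := by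
  ext x
  have hx : x ∈ ⨆ k, U k := by rw [h.submodule_iSup_eq_top]; trivial
  induction hx using Submodule.iSup_induction' with
  | mem k x hx => exact hfg k x hx
  | zero => simp
  | add x y _ _ hx hy => simp [hx, hy]

theorem sum_componentProj (x : V) : ∑ k, (componentProj h k x : V) = x := by
  have : ∑ k, (U k).subtype ∘ₗ componentProj h k = LinearMap.id := by
    refine linearMap_ext_of_isInternal h fun k x hx => ?_
    rw [LinearMap.sum_apply, Finset.sum_eq_single k]
    · simp [componentProj_of_mem h hx]
    · intro l _ hl
      simp [componentProj_of_mem_ne h hl.symm hx]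
    · simp
  simpa using LinearMap.congr_fun this x

end Projection

namespace IsStandardDecomposition

variable {μ : V →ₗ[F] V →ₗ[F] V} {r : ℕ} {U : Fin r → Submodule F V}

theorem mul_left (h : IsStandardDecomposition μ U) {k : Fin r} {y : V} (hy : y ∈ U k) (x : V) :
    μ x y = μ (componentProj h.isInternal k x) y := by
  conv_lhs => rw [← sum_componentProj h.isInternal x]
  rw [map_sum, LinearMap.sum_apply, Finset.sum_eq_single k]
  · intro l _ hl
    exact h.mul_eq_zero l k hl _ (SetLike.coe_mem _) _ hy
  · simp

theorem mul_right (h : IsStandardDecomposition μ U) {k : Fin r} {x : V} (hx : x ∈ U k) (y : V) :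
    μ x y = μ x (componentProj h.isInternal k y) := by
  conv_lhs => rw [← sum_componentProj h.isInternal y]
  rw [map_sum, Finset.sum_eq_single k]
  · intro l _ hl
    exact h.mul_eq_zero k l hl.symm _ hx _ (SetLike.coe_mem _)
  · simp

theorem exists_span (h : IsStandardDecomposition μ U) (k : Fin r) :
    ∃ v, v ≠ 0 ∧ Submodule.map₂ μ (U k) (U k) = Submodule.span F {v} := by
  obtain ⟨⟨v, hv⟩, hv0, hspan⟩ := finrank_eq_one_iff'.1 (h.finrank_sq k)
  refine ⟨v, fun h0 => hv0 (by simp [h0]), le_antisymm (fun x hx => ?_) ?_⟩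
  · obtain ⟨c, hc⟩ := hspan ⟨x, hx⟩
    exact Submodule.mem_span_singleton.2 ⟨c, congrArg Subtype.val hc⟩
  · simpa using hv

theorem sq_eq_span (h : IsStandardDecomposition μ U) {k : Fin r} {v : V} (hv0 : v ≠ 0)
    (hv : v ∈ Submodule.map₂ μ (U k) (U k)) :
    Submodule.map₂ μ (U k) (U k) = Submodule.span F {v} := by
  obtain ⟨w, hw0, hw⟩ := h.exists_span k
  rw [hw] at hv ⊢
  obtain ⟨c, rfl⟩ := Submodule.mem_span_singleton.1 hv
  have hc : c ≠ 0 := by rintro rfl; simp at hv0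
  exact (Submodule.span_singleton_smul_eq hc.isUnit w).symm

/-- Equal squares would span together only a line, not a plane. -/
theorem sq_injective (h : IsStandardDecomposition μ U) {k l : Fin r}
    (hkl : Submodule.map₂ μ (U k) (U k) = Submodule.map₂ μ (U l) (U l)) : k = l := by
  by_contra hne
  have := h.finrank_sq_sup k l hne
  rw [hkl, sup_idem, h.finrank_sq l] at this
  omega

theorem exists_mem_ne_zero (h : IsStandardDecomposition μ U) (k : Fin r) :
    ∃ x ∈ U k, x ≠ 0 := by
  by_contra! H
  have h0 : U k = ⊥ := (Submodule.eq_bot_iff _).2 H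
  have := h.finrank_sq k
  rw [h0, Submodule.map₂_bot_left, finrank_bot] at this
  omega

variable (hE : IsEvolutionAlgebra μ) (hN : IsNondegenerate μ)
include hE hN

/-- An element of a component only sees that component under multiplication, so otherwise it would
lie in the annihilator. -/
theorem exists_mul_ne_zero (h : IsStandardDecomposition μ U) {k : Fin r} {x : V} (hx : x ∈ U k)
    (hx0 : x ≠ 0) : ∃ y ∈ U k, μ x y ≠ 0 := by
  by_contra! H
  refine hx0 (hN x fun y => ?_)
  have : μ x y = 0 := by rw [h.mul_right hx]; exact H _ (SetLike.coe_mem _)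
  exact ⟨this, by rw [hE.comm, this]⟩

/-- The components consist of the elements whose multiples lie on a line. -/
theorem mem_iff (h : IsStandardDecomposition μ U) {k : Fin r} {x : V} :
    x ∈ U k ↔ ∀ y, μ x y ∈ Submodule.map₂ μ (U k) (U k) := by
  refine ⟨fun hx y => ?_, fun hx => ?_⟩
  · rw [h.mul_right hx]
    exact Submodule.apply_mem_map₂ _ hx (SetLike.coe_mem _)
  · have key : ∀ l, l ≠ k → (componentProj h.isInternal l x : V) = 0 := by
      intro l hl
      by_contra h0
      obtain ⟨y, hy, hy0⟩ := h.exists_mul_ne_zero hE hN (SetLike.coe_mem _) h0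
      have h1 := h.sq_eq_span hy0 (Submodule.apply_mem_map₂ _ (SetLike.coe_mem _) hy)
      have h2 := hx y
      rw [h.mul_left hy] at h2
      exact hl (h.sq_injective (h1.trans (h.sq_eq_span hy0 h2).symm))
    rw [← sum_componentProj h.isInternal x, Finset.sum_eq_single k (fun l _ hl => key l hl)
      (by simp)]
    exact SetLike.coe_mem _

/-- Some component `x_k` of `x` is nonzero and has a nonzero product with some `y ∈ U k`. This
product equals `x y`, so it spans both the square of `U k` and the given line. -/
theorem exists_sq_eq (h : IsStandardDecomposition μ U) {x w : V} (hx0 : x ≠ 0)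
    (hx : ∀ y, μ x y ∈ Submodule.span F {w}) :
    ∃ k, Submodule.map₂ μ (U k) (U k) = Submodule.span F {w} := by
  have : ∃ k, (componentProj h.isInternal k x : V) ≠ 0 := by
    by_contra! H
    apply hx0
    rw [← sum_componentProj h.isInternal x]
    simp [H]
  obtain ⟨k, hk⟩ := this
  obtain ⟨y, hy, hy0⟩ := h.exists_mul_ne_zero hE hN (SetLike.coe_mem _) hk
  have h2 := hx y
  rw [h.mul_left hy] at h2
  obtain ⟨c, hc⟩ := Submodule.mem_span_singleton.1 h2
  have hc0 : c ≠ 0 := by rintro rfl; simp at hc; exact hy0 hc.symm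
  refine ⟨k, ?_⟩
  rw [h.sq_eq_span hy0 (Submodule.apply_mem_map₂ _ (SetLike.coe_mem _) hy), ← hc,
    Submodule.span_singleton_smul_eq hc0.isUnit w]

theorem exists_eq {r' : ℕ} {U' : Fin r' → Submodule F V} (h : IsStandardDecomposition μ U)
    (h' : IsStandardDecomposition μ U') (k : Fin r) : ∃ l, U k = U' l := by
  obtain ⟨x, hx, hx0⟩ := h.exists_mem_ne_zero k
  obtain ⟨w, hw0, hw⟩ := h.exists_span k
  obtain ⟨l, hl⟩ := h'.exists_sq_eq hE hN hx0 (w := w) (fun y => hw ▸ (h.mem_iff hE hN).1 hx y)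
  refine ⟨l, ?_⟩
  ext y
  rw [h.mem_iff hE hN, h'.mem_iff hE hN, hl, hw]

/-- The standard decomposition is unique up to the order of its components. -/
theorem exists_equiv {r' : ℕ} {U' : Fin r' → Submodule F V} (h : IsStandardDecomposition μ U)
    (h' : IsStandardDecomposition μ U') : ∃ σ : Fin r ≃ Fin r', ∀ k, U k = U' (σ k) := by
  choose f hf using h.exists_eq hE hN h'
  choose g hg using h'.exists_eq hE hN h
  exact ⟨⟨f, g, fun k => h.sq_injective (by rw [← hg, ← hf]),
    fun k => h'.sq_injective (by rw [← hf, ← hg])⟩, hf⟩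

end IsStandardDecomposition

/-- Such an `S` lies in a single component. This bound is what recovers the independence of columns
from a given index. -/
theorem exists_finrank_le_of_hasDeltaIndex [FiniteDimensional F V] {μ : V →ₗ[F] V →ₗ[F] V}
    {d : List ℕ} (h : HasDeltaIndex μ d) {S : Submodule F V} (hS : S ≠ ⊥) {w : V}
    (hw : ∀ x ∈ S, ∀ y, μ x y ∈ Submodule.span F {w}) : ∃ n ∈ d, Module.finrank F S ≤ n := by
  obtain ⟨hE, hN, r, U, hU, rfl, -⟩ := h
  obtain ⟨x, hx, hx0⟩ := Submodule.exists_mem_ne_zero_of_ne_bot hS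
  obtain ⟨k, hk⟩ := hU.exists_sq_eq hE hN hx0 (hw x hx)
  refine ⟨Module.finrank F (U k), by simp, Submodule.finrank_mono fun y hy => ?_⟩
  rw [hU.mem_iff hE hN, hk]
  exact hw y hy

end Structure

/-! ### Isomorphism invariance of the index and the trace. -/

section Transport

variable {F V W : Type*} [Field F] [AddCommGroup V] [Module F V] [AddCommGroup W] [Module F W]
  {μ : V →ₗ[F] V →ₗ[F] V} {ν : W →ₗ[F] W →ₗ[F] W}

theorem isEvolutionAlgebra_of_basis {n : ℕ} (b : Module.Basis (Fin n) F V)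
    (hb : IsNaturalBasis μ b) : IsEvolutionAlgebra μ := by
  have hn : n = Module.finrank F V := by simp [Module.finrank_eq_card_basis b]
  refine ⟨b.reindex (finCongr hn), fun k l hkl => ?_⟩
  simp only [Module.Basis.reindex_apply]
  exact hb _ _ (by simpa using hkl)

theorem isExtendingSubspace_of_basis {n : ℕ} (b : Module.Basis (Fin n) F V)
    (hb : IsNaturalBasis μ b) (s : Set (Fin n)) :
    IsExtendingSubspace μ (Submodule.span F (b '' s)) := by
  have hn : n = Module.finrank F V := by simp [Module.finrank_eq_card_basis b]
  refine ⟨b.reindex (finCongr hn), fun k l hkl => ?_, finCongr hn '' s, ?_⟩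
  · simp only [Module.Basis.reindex_apply]
    exact hb _ _ (by simpa using hkl)
  · congr 1
    ext x
    constructor
    · rintro ⟨y, hy, rfl⟩
      exact ⟨finCongr hn y, ⟨y, hy, rfl⟩, by simp⟩
    · rintro ⟨_, ⟨y, hy, rfl⟩, rfl⟩
      exact ⟨y, hy, by simp⟩

namespace IsAlgIso

variable {φ : V ≃ₗ[F] W} (hφ : IsAlgIso μ ν φ)
include hφ

theorem isNaturalBasis_map {ι : Type*} {b : Module.Basis ι F V} (hb : IsNaturalBasis μ b) :
    IsNaturalBasis ν (b.map φ) := fun k l hkl => by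
  simp [← hφ (b k) (b l), hb k l hkl]

theorem isEvolutionAlgebra (h : IsEvolutionAlgebra μ) : IsEvolutionAlgebra ν := by
  obtain ⟨b, hb⟩ := h
  exact isEvolutionAlgebra_of_basis _ (hφ.isNaturalBasis_map hb)

theorem isNondegenerate (h : IsNondegenerate μ) : IsNondegenerate ν := fun x hx => by
  rw [← φ.symm.map_eq_zero_iff]
  refine h _ fun y => ?_
  have := hx (φ y)
  rw [← φ.map_eq_zero_iff, ← φ.map_eq_zero_iff, hφ, hφ]
  simpa using this

theorem map₂_map (U U' : Submodule F V) :
    Submodule.map₂ ν (U.map φ.toLinearMap) (U'.map φ.toLinearMap) =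
      (Submodule.map₂ μ U U').map φ.toLinearMap := by
  apply le_antisymm
  · rw [Submodule.map₂_le]
    rintro _ ⟨x, hx, rfl⟩ _ ⟨y, hy, rfl⟩
    exact ⟨μ x y, Submodule.apply_mem_map₂ _ hx hy, hφ x y⟩
  · rw [Submodule.map_le_iff_le_comap, Submodule.map₂_le]
    intro x hx y hy
    simp only [Submodule.mem_comap, LinearEquiv.coe_coe, hφ x y]
    exact Submodule.apply_mem_map₂ _ (Submodule.mem_map_of_mem hx) (Submodule.mem_map_of_mem hy)

theorem isStandardDecomposition_map {r : ℕ} {U : Fin r → Submodule F V}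
    (h : IsStandardDecomposition μ U) :
    IsStandardDecomposition ν fun k => (U k).map φ.toLinearMap where
  isInternal := by
    have := h.isInternal
    rw [DirectSum.isInternal_submodule_iff_iSupIndep_and_iSup_eq_top] at this ⊢
    refine ⟨?_, ?_⟩
    · exact (iSupIndep_map_orderIso_iff (Submodule.orderIsoMapComap φ)).2 this.1
    · rw [← Submodule.map_iSup, this.2, Submodule.map_top, LinearEquiv.range]
  extending k := by
    obtain ⟨b, hb, s, hs⟩ := h.extending k
    have := isExtendingSubspace_of_basis _ (hφ.isNaturalBasis_map hb) s
    rw [hs, Submodule.map_span]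
    convert this using 2
    ext x
    simp
  finrank_sq k := by
    rw [hφ.map₂_map, LinearEquiv.finrank_map_eq φ, h.finrank_sq]
  mul_eq_zero k l hkl := by
    rintro _ ⟨x, hx, rfl⟩ _ ⟨y, hy, rfl⟩
    simp [← hφ x y, h.mul_eq_zero k l hkl x hx y hy]
  finrank_sq_sup k l hkl := by
    rw [hφ.map₂_map, hφ.map₂_map, ← Submodule.map_sup, LinearEquiv.finrank_map_eq φ,
      h.finrank_sq_sup k l hkl]

/-- `φ` maps components to components, hence it intertwines the two projections, which is checked on
each component; its restriction is then the isomorphism. -/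
theorem isomorphic_associatedProduct {r r' : ℕ} {U : Fin r → Submodule F V}
    {U' : Fin r' → Submodule F W} (h : DirectSum.IsInternal U) (h' : DirectSum.IsInternal U')
    (σ : Fin r ≃ Fin r') (hU : ∀ k, (U k).map φ.toLinearMap = U' (σ k)) (k : Fin r) :
    Isomorphic (associatedProduct μ h k) (associatedProduct ν h' (σ k)) := by
  have key : φ.toLinearMap ∘ₗ (U k).subtype ∘ₗ componentProj h k =
      (U' (σ k)).subtype ∘ₗ componentProj h' (σ k) ∘ₗ φ.toLinearMap := by
    refine linearMap_ext_of_isInternal h fun l x hx => ?_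
    have hx' : φ x ∈ U' (σ l) := hU l ▸ Submodule.mem_map_of_mem hx
    by_cases hl : l = k
    · subst hl
      simp [componentProj_of_mem h hx, componentProj_of_mem h' hx']
    · simp [componentProj_of_mem_ne h hl hx,
        componentProj_of_mem_ne h' (σ.injective.ne hl) hx']
  refine ⟨(φ.submoduleMap (U k)).trans (LinearEquiv.ofEq _ _ (hU k)), fun x y => ?_⟩
  apply Subtype.ext
  have := LinearMap.congr_fun key (μ x y)
  simp only [LinearMap.comp_apply, LinearEquiv.coe_coe, hφ (x : V) y] at this
  exact this

end IsAlgIso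

theorem HasDeltaIndex.of_isomorphic {d : List ℕ} (hd : HasDeltaIndex μ d) (h : Isomorphic μ ν) :
    HasDeltaIndex ν d := by
  obtain ⟨φ, hφ⟩ := h
  obtain ⟨hE, hN, r, U, hU, rfl, hs⟩ := hd
  refine ⟨hφ.isEvolutionAlgebra hE, hφ.isNondegenerate hN, r, _,
    hφ.isStandardDecomposition_map hU, ?_, hs⟩
  congr 1
  ext k
  exact (LinearEquiv.finrank_map_eq φ (U k)).symm

theorem HasDeltaTrace.of_isomorphic {i : F} {t : List Block} (ht : HasDeltaTrace i μ t)
    (h : Isomorphic μ ν) : HasDeltaTrace i ν t := by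
  obtain ⟨φ, hφ⟩ := h
  obtain ⟨hE, hN, r, U, hU, T, hT, rfl, hs⟩ := ht
  have hU' := hφ.isStandardDecomposition_map hU
  refine ⟨hφ.isEvolutionAlgebra hE, hφ.isNondegenerate hN, r, _, hU', T,
    fun k => ⟨(hT k).1, ?_⟩, rfl, hs⟩
  exact (hφ.isomorphic_associatedProduct hU.isInternal hU'.isInternal (Equiv.refl _)
    (fun _ => rfl) k).symm.trans (hT k).2

theorem HasDeltaIndex.unique {d d' : List ℕ} (h : HasDeltaIndex μ d) (h' : HasDeltaIndex μ d') :
    d = d' := by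
  obtain ⟨hE, hN, r, U, hU, rfl, hs⟩ := h
  obtain ⟨-, -, r', U', hU', rfl, hs'⟩ := h'
  obtain ⟨σ, hσ⟩ := hU.exists_equiv hE hN hU'
  obtain rfl : r = r' := by simpa using Fintype.card_congr σ
  refine List.Perm.eq_of_pairwise (fun a b _ _ h1 h2 => le_antisymm h2 h1) hs hs' ?_
  rw [show (fun k => Module.finrank F (U k)) = (fun k => Module.finrank F (U' k)) ∘ σ from
    funext fun k => congrArg (fun S : Submodule F V => Module.finrank F S) (hσ k)]
  exact Equiv.Perm.ofFn_comp_perm σ _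

theorem ofMatrix_apply {n : ℕ} (M : Matrix (Fin n) (Fin n) F) (x y : Fin n → F) (k : Fin n) :
    ofMatrix M x y k = ∑ j, M k j * (x j * y j) := rfl

/-- Every square is a multiple of `e_1 + i e_2`, whose own square vanishes because `1 + i² = 0`. -/
theorem Block.sq_sq_eq_zero {i : F} (hi : i ^ 2 = -1) {n : ℕ} (hn : 2 ≤ n) (x : Fin n → F) :
    let ν := ofMatrix ((⟨.I, n⟩ : Block).matrix i)
    ν (ν x x) (ν x x) = 0 := by
  intro ν
  obtain ⟨m, rfl⟩ := Nat.exists_eq_add_of_le' hn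
  ext k
  simp only [ν, ofMatrix_apply, Block.matrix, Matrix.of_apply, ← Finset.mul_sum]
  generalize ∑ j, x j * x j = c
  rw [Fin.sum_univ_succ, Fin.sum_univ_succ]
  have : c * c + i * c * (i * c) = 0 := by linear_combination c ^ 2 * hi
  simp [this]

theorem Block.eq_of_isomorphic {i : F} (hi : i ^ 2 = -1) {B C : Block} (hB : B.Valid)
    (hC : C.Valid) (hdim : 0 < B.dim)
    (h : Isomorphic (ofMatrix (B.matrix i)) (ofMatrix (C.matrix i))) : B = C := by
  wlog hr : B.kind.rank ≤ C.kind.rank generalizing B C with H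
  · refine (H hC hB ?_ h.symm (by omega)).symm
    obtain ⟨φ, -⟩ := h
    have := φ.finrank_eq
    simp at this
    omega
  obtain ⟨φ, hφ⟩ := h
  have hd := φ.finrank_eq
  simp only [Module.finrank_fintype_fun_eq_card, Fintype.card_fin] at hd
  obtain ⟨K, n⟩ := B
  obtain ⟨L, n'⟩ := C
  dsimp only at hd hdim
  subst hd
  obtain ⟨m, rfl⟩ : ∃ m, n = m + 1 := ⟨n - 1, by omega⟩
  have hO (L : Kind) (hL : L ≠ .O)
      (φ : (Fin (m + 1) → F) ≃ₗ[F] (Fin (m + 1) → F))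
      (hφ : IsAlgIso (ofMatrix ((⟨.O, m + 1⟩ : Block).matrix i))
        (ofMatrix ((⟨L, m + 1⟩ : Block).matrix i)) φ) : False := by
    have h1 := hφ (φ.symm (Pi.single 0 1)) (φ.symm (Pi.single 0 1))
    have h2 := congrFun h1 0
    have h3 : ofMatrix ((⟨.O, m + 1⟩ : Block).matrix i) = 0 := by
      ext; simp [ofMatrix, Block.matrix]
    rw [h3] at h2
    cases L <;> simp [ofMatrix_apply, Block.matrix, Pi.single_apply] at h2 hL
  cases K <;> cases L <;> simp [Kind.rank] at hr ⊢
  · exact hO _ (by simp) φ hφ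
  · exact hO _ (by simp) φ hφ
  -- Only `E` against `I` remains: in `E_n` the vector `e_1` is idempotent, so `(e_1²)² ≠ 0`.
  · have h1 := Block.sq_sq_eq_zero hi (hC rfl) (φ (Pi.single 0 1))
    dsimp only at h1
    rw [← hφ, ← hφ, LinearEquiv.map_eq_zero_iff] at h1
    have h2 := congrFun h1 0
    simp [ofMatrix_apply, Block.matrix, Pi.single_apply] at h2

theorem HasDeltaTrace.unique {i : F} (hi : i ^ 2 = -1) {t t' : List Block}
    (h : HasDeltaTrace i μ t) (h' : HasDeltaTrace i μ t') : t = t' := by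
  obtain ⟨hE, hN, r, U, hU, T, hT, rfl, hs⟩ := h
  obtain ⟨-, -, r', U', hU', T', hT', rfl, hs'⟩ := h'
  obtain ⟨σ, hσ⟩ := hU.exists_equiv hE hN hU'
  obtain rfl : r = r' := by simpa using Fintype.card_congr σ
  have hTT : T = T' ∘ σ := by
    ext1 k
    have h1 := (show IsAlgIso μ μ (LinearEquiv.refl F V) from fun _ _ => rfl)
      |>.isomorphic_associatedProduct hU.isInternal hU'.isInternal σ (fun k => by simp [hσ]) k
    refine Block.eq_of_isomorphic hi (hT k).1 (hT' (σ k)).1 ?_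
      ((hT k).2.symm.trans (h1.trans (hT' (σ k)).2))
    by_contra h0
    obtain ⟨φ, -⟩ := (hT k).2
    obtain ⟨x, hx, hx0⟩ := hU.exists_mem_ne_zero k
    have : IsEmpty (Fin (T k).dim) := by rw [Nat.eq_zero_of_not_pos h0]; infer_instance
    have h2 : (⟨x, hx⟩ : U k) = 0 := φ.injective (Subsingleton.elim _ _)
    exact hx0 (congrArg Subtype.val h2)
  refine List.Perm.eq_of_pairwise (fun a b _ _ h1 h2 => ?_) hs hs' ?_
  · obtain ⟨K, n⟩ := a
    obtain ⟨L, n'⟩ := b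
    simp only [Block.Ge] at h1 h2
    have : n = n' := by omega
    subst this
    cases K <;> cases L <;> simp [Kind.rank] at h1 h2 ⊢
  · rw [hTT]
    exact Equiv.Perm.ofFn_comp_perm σ _

end Transport

/-! ### Decomposition read off from the columns of a structure matrix. -/

section Matrices

variable {F : Type*} [Field F] {n r : ℕ}

theorem ofMatrix_single_single (M : Matrix (Fin n) (Fin n) F) (j : Fin n) :
    ofMatrix M (Pi.single j 1) (Pi.single j 1) = M.col j := by
  ext k
  rw [ofMatrix_apply, Finset.sum_eq_single j] <;> simp +contextual

theorem ofMatrix_apply_single (M : Matrix (Fin n) (Fin n) F) (x : Fin n → F) (j : Fin n) :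
    ofMatrix M x (Pi.single j 1) = x j • M.col j := by
  ext k
  rw [ofMatrix_apply, Finset.sum_eq_single j] <;> simp +contextual [mul_comm]

theorem ofMatrix_comm (M : Matrix (Fin n) (Fin n) F) (x y : Fin n → F) :
    ofMatrix M x y = ofMatrix M y x := by
  ext k; simp [ofMatrix_apply, mul_comm]

theorem isNaturalBasis_basisFun (M : Matrix (Fin n) (Fin n) F) :
    IsNaturalBasis (ofMatrix M) (Pi.basisFun F (Fin n)) := fun k l hkl => by
  simp [ofMatrix_apply_single, hkl]

theorem isEvolutionAlgebra_ofMatrix (M : Matrix (Fin n) (Fin n) F) :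
    IsEvolutionAlgebra (ofMatrix M) :=
  isEvolutionAlgebra_of_basis _ (isNaturalBasis_basisFun M)

theorem isNondegenerate_ofMatrix_iff {M : Matrix (Fin n) (Fin n) F} :
    IsNondegenerate (ofMatrix M) ↔ ∀ j, M.col j ≠ 0 := by
  constructor
  · intro h j hj
    have := h (Pi.single j 1) fun y => by
      have h1 : ofMatrix M (Pi.single j 1) y = 0 := by
        rw [ofMatrix_comm, ofMatrix_apply_single, hj, smul_zero]
      exact ⟨h1, by rw [ofMatrix_comm, h1]⟩
    simp at this
  · intro h x hx
    ext j
    have := (hx (Pi.single j 1)).1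
    rw [ofMatrix_apply_single, smul_eq_zero] at this
    exact this.resolve_right (h j)

/-- The vectors supported on the fibre of `f` over `k`. -/
def fiberSubspace (F : Type*) [Field F] (f : Fin n → Fin r) (k : Fin r) :
    Submodule F (Fin n → F) where
  carrier := {x | ∀ j, f j ≠ k → x j = 0}
  add_mem' hx hy j hj := by simp [hx j hj, hy j hj]
  zero_mem' := by simp
  smul_mem' c x hx j hj := by simp [hx j hj]

theorem single_mem_fiberSubspace (f : Fin n → Fin r) (j : Fin n) (c : F) :
    Pi.single j c ∈ fiberSubspace F f (f j) := fun l hl => by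
  rw [Pi.single_eq_of_ne]
  rintro rfl
  exact hl rfl

theorem fiberSubspace_eq_span (f : Fin n → Fin r) (k : Fin r) :
    fiberSubspace F f k = Submodule.span F (Pi.basisFun F (Fin n) '' {j | f j = k}) := by
  apply le_antisymm
  · intro x hx
    rw [← (Pi.basisFun F (Fin n)).sum_repr x]
    refine Submodule.sum_mem _ fun j _ => ?_
    by_cases hj : f j = k
    · exact Submodule.smul_mem _ _ (Submodule.subset_span ⟨j, hj, rfl⟩)
    · simp [hx j hj]
  · rw [Submodule.span_le]
    rintro _ ⟨j, rfl, rfl⟩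
    simpa using single_mem_fiberSubspace f j 1

theorem isInternal_fiberSubspace (f : Fin n → Fin r) :
    DirectSum.IsInternal (fiberSubspace F f) := by
  apply DirectSum.isInternal_submodule_of_iSupIndep_of_iSup_eq_top
  · rw [iSupIndep_iff_finsetSum_eq_zero_imp_eq_zero]
    intro s x hx h0 k hk
    ext j
    by_cases hj : f j = k
    · have := congrFun h0 j
      rw [Finset.sum_apply, Finset.sum_eq_single k] at this
      · exact this
      · intro l hl hlk
        exact hx l hl j (by rw [hj]; exact hlk.symm)
      · exact fun h => absurd hk h
    · exact hx k hk j hj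
  · rw [eq_top_iff]
    intro x _
    rw [← (Pi.basisFun F (Fin n)).sum_repr x]
    refine Submodule.sum_mem _ fun j _ => Submodule.smul_mem _ _ ?_
    refine Submodule.mem_iSup_of_mem (f j) ?_
    simpa using single_mem_fiberSubspace f j 1

theorem componentProj_fiberSubspace_apply {f : Fin n → Fin r} {k : Fin r} {j : Fin n}
    (hj : f j = k) (z : Fin n → F) :
    (componentProj (U := fiberSubspace F f) (isInternal_fiberSubspace f) k z : Fin n → F) j =
      z j := by
  conv_rhs => rw [← sum_componentProj (U := fiberSubspace F f) (isInternal_fiberSubspace f) z]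
  rw [Finset.sum_apply, Finset.sum_eq_single k]
  · intro l _ hl
    exact (componentProj (U := fiberSubspace F f) (isInternal_fiberSubspace f) l z).2 _
      (by rw [hj]; exact hl.symm)
  · simp

section Decomposition

variable {f : Fin n → Fin r} {v : Fin r → Fin n → F} {M : Matrix (Fin n) (Fin n) F}
  (hM : ∀ k j, M k j = v (f j) k)
include hM

theorem ofMatrix_of_mem_fiberSubspace {k : Fin r} {x : Fin n → F} (hx : x ∈ fiberSubspace F f k)
    (y : Fin n → F) : ofMatrix M x y = (∑ j, x j * y j) • v k := by
  ext l
  simp only [ofMatrix_apply, Pi.smul_apply, smul_eq_mul, Finset.sum_mul]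
  refine Finset.sum_congr rfl fun j _ => ?_
  by_cases hj : f j = k
  · rw [hM, hj, mul_comm]
  · simp [hx j hj]

variable (hf : Function.Surjective f)
include hf

theorem map₂_fiberSubspace (k : Fin r) :
    Submodule.map₂ (ofMatrix M) (fiberSubspace F f k) (fiberSubspace F f k) =
      Submodule.span F {v k} := by
  apply le_antisymm
  · rw [Submodule.map₂_le]
    intro x hx y _
    rw [ofMatrix_of_mem_fiberSubspace hM hx]
    exact Submodule.smul_mem _ _ (Submodule.mem_span_singleton_self _)
  · obtain ⟨j, rfl⟩ := hf k
    rw [Submodule.span_singleton_le_iff_mem]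
    have := Submodule.apply_mem_map₂ (ofMatrix M) (single_mem_fiberSubspace f j (1 : F))
      (single_mem_fiberSubspace f j (1 : F))
    rw [ofMatrix_single_single] at this
    convert this using 1
    ext k
    exact (hM k j).symm

variable (hv0 : ∀ k, v k ≠ 0) (hv : ∀ k l, k ≠ l → LinearIndependent F ![v k, v l])
include hv0 hv

/-- Here `f` assigns a component to each basis vector and `v k` is the common square of the basis
vectors in component `k`; `map₂_fiberSubspace` makes the line of `v k` the square of that component.
-/
theorem isStandardDecomposition_fiberSubspace :
    IsStandardDecomposition (ofMatrix M) (fiberSubspace F f) where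
  isInternal := isInternal_fiberSubspace f
  extending k := by
    rw [fiberSubspace_eq_span]
    exact isExtendingSubspace_of_basis _ (isNaturalBasis_basisFun M) _
  finrank_sq k := by
    rw [map₂_fiberSubspace hM hf, finrank_span_singleton (hv0 k)]
  mul_eq_zero k l hkl x hx y hy := by
    rw [ofMatrix_of_mem_fiberSubspace hM hx, Finset.sum_eq_zero, zero_smul]
    intro j _
    by_cases hj : f j = k
    · rw [hy j (by rwa [hj]), mul_zero]
    · rw [hx j hj, zero_mul]
  finrank_sq_sup k l hkl := by
    rw [map₂_fiberSubspace hM hf, map₂_fiberSubspace hM hf, ← Submodule.span_union,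
      Set.singleton_union]
    have hr : ({v k, v l} : Set (Fin n → F)) = Set.range ![v k, v l] := by
      ext x
      simp [or_comm]
    rw [hr]
    simpa using finrank_span_eq_card (hv k l hkl)

omit hf hv in
theorem isNondegenerate_of_columns : IsNondegenerate (ofMatrix M) := by
  rw [isNondegenerate_ofMatrix_iff]
  intro j hj
  refine hv0 (f j) ?_
  ext k
  rw [← hM]
  exact congrFun hj k

omit hM hf hv0 hv in
/-- Reading off the coordinates in a fibre of `f` that is enumerated by `g k`. -/
theorem exists_equiv_fiberSubspace {d : Fin r → ℕ} {g : Fin r → ℕ → Fin n}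
    (hfg : ∀ k, ∀ p < d k, f (g k p) = k)
    (hg : ∀ k, ∀ p < d k, ∀ q < d k, g k p = g k q → p = q)
    (hgs : ∀ j, ∃ p < d (f j), g (f j) p = j) (k : Fin r) :
    ∃ e : fiberSubspace F f k ≃ₗ[F] (Fin (d k) → F), ∀ x p, e x p = (x : Fin n → F) (g k p) := by
  refine ⟨LinearEquiv.ofBijective
    ((LinearMap.funLeft F F fun p : Fin (d k) => g k p) ∘ₗ (fiberSubspace F f k).subtype)
    ⟨?_, fun y => ?_⟩, fun x p => rfl⟩
  · rw [injective_iff_map_eq_zero]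
    rintro ⟨x, hx⟩ h0
    ext j
    by_cases hj : f j = k
    · subst hj
      obtain ⟨p, hp, hpj⟩ := hgs j
      have := congrFun h0 ⟨p, hp⟩
      simpa [hpj] using this
    · exact hx j hj
  · have hinj : Function.Injective fun p : Fin (d k) => g k p := fun p q hpq =>
      Fin.ext (hg k p p.2 q q.2 hpq)
    refine ⟨⟨Function.extend (fun p : Fin (d k) => g k p) y 0, fun j hj => ?_⟩, ?_⟩
    · rw [Function.extend_apply']
      · rfl
      · rintro ⟨p, rfl⟩
        exact hj (hfg k p p.2)
    · ext p
      exact hinj.extend_apply y 0 p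

theorem hasDeltaIndex_of_columns {d : Fin r → ℕ} {g : Fin r → ℕ → Fin n}
    (hfg : ∀ k, ∀ p < d k, f (g k p) = k)
    (hg : ∀ k, ∀ p < d k, ∀ q < d k, g k p = g k q → p = q)
    (hgs : ∀ j, ∃ p < d (f j), g (f j) p = j) (hd : (List.ofFn d).Pairwise (· ≥ ·)) :
    HasDeltaIndex (ofMatrix M) (List.ofFn d) := by
  refine ⟨isEvolutionAlgebra_ofMatrix M, isNondegenerate_of_columns hM hv0, r, _,
    isStandardDecomposition_fiberSubspace hM hf hv0 hv, ?_, hd⟩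
  congr 1
  ext k
  obtain ⟨e, -⟩ := exists_equiv_fiberSubspace (F := F) hfg hg hgs k
  simp [e.finrank_eq]

/-- The values `g k p` with `p < d k` enumerate the fibre over `k`; values at larger `p` are
irrelevant. In these coordinates the projected product is the bilinear form `∑ x_j y_j` times the
projection of `v k`. -/
theorem hasDeltaTrace_of_columns {i : F} {d : Fin r → ℕ} {g : Fin r → ℕ → Fin n}
    (hfg : ∀ k, ∀ p < d k, f (g k p) = k)
    (hg : ∀ k, ∀ p < d k, ∀ q < d k, g k p = g k q → p = q)
    (hgs : ∀ j, ∃ p < d (f j), g (f j) p = j) {K : Fin r → Kind}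
    (hK : ∀ k, (⟨K k, d k⟩ : Block).Valid)
    (hKv : ∀ k p q, (⟨K k, d k⟩ : Block).matrix i p q = v k (g k p))
    (hd : (List.ofFn fun k => (⟨K k, d k⟩ : Block)).Pairwise Block.Ge) :
    HasDeltaTrace i (ofMatrix M) (List.ofFn fun k => ⟨K k, d k⟩) := by
  refine ⟨isEvolutionAlgebra_ofMatrix M, isNondegenerate_of_columns hM hv0, r, _,
    isStandardDecomposition_fiberSubspace hM hf hv0 hv, _, fun k => ⟨hK k, ?_⟩, rfl, hd⟩
  obtain ⟨e, he⟩ := exists_equiv_fiberSubspace (F := F) hfg hg hgs k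
  refine ⟨e, fun x y => ?_⟩
  ext p
  refine ((he _ p).trans (componentProj_fiberSubspace_apply (hfg k p p.2) _)).trans ?_
  rw [LinearMap.domRestrict₁₂_apply, ofMatrix_of_mem_fiberSubspace hM x.2, ofMatrix_apply, Pi.smul_apply, smul_eq_mul,
    Finset.sum_mul]
  simp only [hKv, he]
  have hinj : Function.Injective fun p : Fin (d k) => g k p := fun p q hpq =>
    Fin.ext (hg k p p.2 q q.2 hpq)
  refine (Finset.sum_of_injOn (fun p : Fin (d k) => g k p) hinj.injOn (by simp) ?_ ?_).symm
  · intro j _ hj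
    rw [x.2 j, zero_mul, zero_mul]
    rintro rfl
    obtain ⟨p, hp, hpj⟩ := hgs j
    exact hj ⟨⟨p, hp⟩, by simp, hpj⟩
  · intro q _
    ring

end Decomposition

end Matrices

/-! ### Monomial isomorphisms. -/

section MonomialMaps

variable {F : Type*} [Field F] {n : ℕ} {M M' : Matrix (Fin n) (Fin n) F}

/-- The map is `e_j ↦ x_j e_{σ j}`; the hypothesis compares the two images of `e_j²` coordinate by
coordinate. -/
theorem isomorphic_of_perm (σ : Equiv.Perm (Fin n)) {x : Fin n → F} (hx : ∀ j, x j ≠ 0)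
    (h : ∀ k j, x k * M k j = x j ^ 2 * M' (σ k) (σ j)) :
    Isomorphic (ofMatrix M) (ofMatrix M') := by
  refine ⟨(LinearEquiv.piCongrRight fun j => LinearEquiv.smulOfNeZero F F (x j) (hx j)).trans
    (LinearEquiv.funCongrLeft F F σ.symm), fun y z => ?_⟩
  ext k
  obtain ⟨k, rfl⟩ := σ.surjective k
  rw [ofMatrix_apply, ← Equiv.sum_comp σ]
  simp only [LinearEquiv.trans_apply, LinearEquiv.funCongrLeft_apply, LinearMap.funLeft_apply,
    Equiv.symm_apply_apply, LinearEquiv.piCongrRight_apply, LinearEquiv.smulOfNeZero_apply,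
    smul_eq_mul, ofMatrix_apply, Finset.mul_sum]
  exact Finset.sum_congr rfl fun j _ => by linear_combination (y j * z j) * h k j

theorem isomorphic_submatrix (M : Matrix (Fin n) (Fin n) F) (σ : Equiv.Perm (Fin n)) :
    Isomorphic (ofMatrix M) (ofMatrix (M.submatrix σ σ)) :=
  isomorphic_of_perm σ.symm (x := 1) (by simp) (by simp)

/-- If the squares of the basis vectors of the target are pairwise independent, an isomorphism is
given by a monomial matrix. -/
theorem IsAlgIso.exists_perm {φ : (Fin n → F) ≃ₗ[F] (Fin n → F)}
    (hφ : IsAlgIso (ofMatrix M) (ofMatrix M') φ)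
    (hM' : ∀ j l, j ≠ l → LinearIndependent F ![M'.col j, M'.col l]) :
    ∃ (σ : Equiv.Perm (Fin n)) (x : Fin n → F), (∀ j, x j ≠ 0) ∧
      (∀ j, φ (Pi.single j 1) = x j • Pi.single (σ j) 1) ∧
      ∀ k j, x k * M k j = x j ^ 2 * M' (σ k) (σ j) := by
  -- With `z = φ⁻¹ e_l`, the product `e_j z` is `z_j e_j²`; apply `φ`.
  have hline : ∀ j l, ∃ c : F, φ (Pi.single j 1) l • M'.col l = c • φ (M.col j) := by
    intro j l
    refine ⟨φ.symm (Pi.single l 1) j, ?_⟩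
    rw [← ofMatrix_apply_single, ← map_smul, ← ofMatrix_apply_single, ofMatrix_comm M, hφ,
      LinearEquiv.apply_symm_apply]
  have hne : ∀ j, ∃ l, φ (Pi.single j 1) l ≠ 0 := by
    intro j
    by_contra! H
    have : φ (Pi.single j 1) = 0 := funext H
    simp at this
  choose s hs using hne
  have hs0 : ∀ j l, l ≠ s j → φ (Pi.single j 1) l = 0 := by
    intro j l hl
    by_contra h0
    obtain ⟨c, hc⟩ := hline j l
    obtain ⟨c', hc'⟩ := hline j (s j)
    -- Columns `l` and `s j` of `M'`, after scaling by the coordinates of `φ e_j`, are multiples of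
    -- the same vector `φ (M.col j)`; cross-multiplying by `c'` and `c` gives a linear relation
    -- between them.
    have hLI := LinearIndependent.pair_iff.1 (hM' l (s j) hl)
      (c' * φ (Pi.single j 1) l) (-(c * φ (Pi.single j 1) (s j))) (by
        rw [neg_smul, mul_smul, mul_smul, hc, hc', smul_smul, smul_smul, mul_comm c, add_neg_cancel])
    have hc'0 : c' = 0 := by simpa [h0] using hLI.1
    rw [hc'0, zero_smul, smul_eq_zero] at hc'
    rcases hc' with h | h
    · exact hs j h
    · exact (hM' l (s j) hl).ne_zero 1 (by simpa using h)
  have hφs : ∀ j, φ (Pi.single j 1) = φ (Pi.single j 1) (s j) • Pi.single (s j) 1 := by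
    intro j
    ext l
    by_cases hl : l = s j
    · subst hl; simp
    · simp [hs0 j l hl, hl]
  have hsinj : Function.Injective s := by
    intro j l hjl
    by_contra hne
    have h1 : φ (φ (Pi.single l 1) (s l) • Pi.single j 1 - φ (Pi.single j 1) (s j) • Pi.single l 1)
        = 0 := by
      rw [map_sub, map_smul, map_smul, hφs j, hφs l, hjl]
      simp [smul_smul, mul_comm]
    rw [LinearEquiv.map_eq_zero_iff] at h1
    have h2 := congrFun h1 j
    simp [hne] at h2
    exact hs l h2
  refine ⟨Equiv.ofBijective s (Finite.injective_iff_bijective.1 hsinj),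
    fun j => φ (Pi.single j 1) (s j), hs, hφs, fun k j => ?_⟩
  have h1 := congrFun (hφ (Pi.single j 1) (Pi.single j 1)) (s k)
  rw [ofMatrix_single_single, hφs j] at h1
  simp only [map_smul, LinearMap.smul_apply, ofMatrix_single_single, Pi.smul_apply,
    smul_eq_mul, Matrix.col_apply] at h1
  have h2 : M.col j = ∑ l, M l j • Pi.single l 1 := by
    ext l; simp [Finset.sum_apply, Pi.single_apply]
  rw [h2, map_sum, Finset.sum_apply, Finset.sum_eq_single k] at h1
  · simp only [map_smul, Pi.smul_apply, smul_eq_mul] at h1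
    simp only [Equiv.ofBijective_apply]
    linear_combination h1
  · intro l _ hl
    rw [map_smul, Pi.smul_apply, hs0 l _ (hsinj.ne hl.symm), smul_zero]
  · simp

end MonomialMaps

/-! ### Index and trace in dimension three. -/

section DimensionThree

variable {F : Type*} [Field F] {M : Matrix (Fin 3) (Fin 3) F}

/-- The `p`-th coordinate of the square of a basis vector in `O_n`, `E_n` or `I_n`. -/
def Kind.coord (i : F) : Kind → ℕ → F
  | .O, _ => 0
  | .E, p => if p = 0 then 1 else 0
  | .I, p => if p = 0 then 1 else if p = 1 then i else 0

theorem Block.matrix_apply (i : F) (K : Kind) (d : ℕ) (p q : Fin d) :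
    (⟨K, d⟩ : Block).matrix i p q = K.coord i p := by
  cases K <;> rfl

theorem hasDeltaIndex_one_one_one (h : ∀ j l, j ≠ l → LinearIndependent F ![M.col j, M.col l]) :
    HasDeltaIndex (ofMatrix M) [1, 1, 1] := by
  have h0 : ∀ j, M.col j ≠ 0 := fun j => (h j (j + 1) (by simp)).ne_zero 0
  exact hasDeltaIndex_of_columns (f := id) (v := M.col) (d := ![1, 1, 1]) (g := fun k _ => k)
    (fun _ _ => rfl) Function.surjective_id h0 h (by decide) (by decide) (by decide)
    (by simp)

theorem hasDeltaTrace_one_one_one (h : ∀ j l, j ≠ l → LinearIndependent F ![M.col j, M.col l])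
    {i : F} (K : Fin 3 → Kind) (hK : ∀ j, K j ≠ .I) (hKM : ∀ j, M j j = (K j).coord i 0)
    (hs : (K 0).rank ≤ (K 1).rank ∧ (K 1).rank ≤ (K 2).rank) :
    HasDeltaTrace i (ofMatrix M) [⟨K 0, 1⟩, ⟨K 1, 1⟩, ⟨K 2, 1⟩] := by
  have h0 : ∀ j, M.col j ≠ 0 := fun j => (h j (j + 1) (by simp)).ne_zero 0
  exact hasDeltaTrace_of_columns (f := id) (v := M.col) (d := fun _ => 1) (g := fun k _ => k)
    (fun _ _ => rfl) Function.surjective_id h0 h (by decide) (by decide) (by decide)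
    (fun k hk => absurd hk (hK k)) (fun k p q => by
      rw [Block.matrix_apply, Matrix.col_apply, hKM]; congr; omega)
    (by simp [Block.Ge, hs, hs.1.trans hs.2])

/-- If two columns were proportional, the plane `S` spanned by the two basis vectors would have all
its multiples on one line, hence lie in a component of dimension 1. -/
theorem linearIndependent_col_of_hasDeltaIndex (h : HasDeltaIndex (ofMatrix M) [1, 1, 1])
    (j l : Fin 3) (hjl : j ≠ l) : LinearIndependent F ![M.col j, M.col l] := by
  rw [LinearIndependent.pair_iff' (isNondegenerate_ofMatrix_iff.1 h.2.1 j)]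
  intro a ha
  set S := Submodule.span F (Set.range ![(Pi.single j 1 : Fin 3 → F), Pi.single l 1])
  have hS : Module.finrank F S = 2 := by
    rw [finrank_span_eq_card]
    · simp
    · rw [LinearIndependent.pair_iff]
      intro s t hst
      have h1 := congrFun hst j
      have h2 := congrFun hst l
      simp [hjl] at h1 
      simp [hjl.symm] at h2 
      exact ⟨h1, h2⟩
  obtain ⟨n, hn, hn'⟩ := exists_finrank_le_of_hasDeltaIndex h (S := S) (w := M.col j)
    (by rintro h0; rw [h0, finrank_bot] at hS; omega) (by
      intro x hx y
      have hle : S ≤ (Submodule.span F {M.col j}).comap ((ofMatrix M).flip y) := by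
        rw [Submodule.span_le]
        rintro _ ⟨m, rfl⟩
        simp only [SetLike.mem_coe, Submodule.mem_comap, LinearMap.flip_apply]
        fin_cases m
        · simp only [Fin.zero_eta, Matrix.cons_val_zero]
          rw [ofMatrix_comm, ofMatrix_apply_single]
          exact Submodule.smul_mem _ _ (Submodule.mem_span_singleton_self _)
        · simp only [Fin.mk_one, Matrix.cons_val_one, Matrix.cons_val_zero]
          rw [ofMatrix_comm, ofMatrix_apply_single, ← ha]
          exact Submodule.smul_mem _ _ (Submodule.smul_mem _ _ (Submodule.mem_span_singleton_self _))
      exact hle hx)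
  simp at hn
  omega

theorem hasDeltaIndex_two_one (hM : ∀ k, M k 1 = M k 0)
    (h : LinearIndependent F ![M.col 0, M.col 2]) :
    HasDeltaIndex (ofMatrix M) [2, 1] := by
  exact hasDeltaIndex_of_columns (f := ![0, 0, 1]) (v := ![M.col 0, M.col 2]) (d := ![2, 1])
    -- The formula lists the indices 0, 1 for the first component and 2 for the second.
    (g := fun k p => Fin.ofNat 3 (2 * k + p))
    (fun k j => by fin_cases j <;> simp [hM]) (by decide) h.ne_zero (by
      have := LinearIndependent.pair_symm_iff.1 h
      intro k l hkl
      fin_cases k <;> fin_cases l <;> simp_all) (by decide) (by decide) (by decide)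
    (by simp)

theorem hasDeltaTrace_two_one (hM : ∀ k, M k 1 = M k 0)
    (h : LinearIndependent F ![M.col 0, M.col 2]) {i : F} (K L : Kind) (hL : L ≠ .I)
    (h0 : M 0 0 = K.coord i 0) (h1 : M 1 0 = K.coord i 1) (h2 : M 2 2 = L.coord i 0) :
    HasDeltaTrace i (ofMatrix M) [⟨K, 2⟩, ⟨L, 1⟩] := by
  exact hasDeltaTrace_of_columns (f := ![0, 0, 1]) (v := ![M.col 0, M.col 2]) (d := ![2, 1])
    (g := fun k p => Fin.ofNat 3 (2 * k + p)) (K := ![K, L])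
    (fun k j => by fin_cases j <;> simp [hM]) (by decide) h.ne_zero (by
      have := LinearIndependent.pair_symm_iff.1 h
      intro k l hkl
      fin_cases k <;> fin_cases l <;> simp_all) (by decide) (by decide) (by decide)
    (fun k => by fin_cases k <;> simp [Block.Valid, hL]) (fun k p q => by
      rw [Block.matrix_apply]
      fin_cases k <;> fin_cases p
      exacts [h0.symm, h1.symm, h2.symm])
    (by simp [Block.Ge])

/-- Otherwise all products lie on one line, and the whole space would be a single component of
dimension 3. -/
theorem linearIndependent_of_hasDeltaIndex_two_one (hM : ∀ k, M k 1 = M k 0)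
    (h : HasDeltaIndex (ofMatrix M) [2, 1]) : LinearIndependent F ![M.col 0, M.col 2] := by
  rw [LinearIndependent.pair_iff' (isNondegenerate_ofMatrix_iff.1 h.2.1 0)]
  intro a ha
  obtain ⟨n, hn, hn'⟩ := exists_finrank_le_of_hasDeltaIndex h (S := ⊤) (w := M.col 0)
    (by simp) (by
      intro x _ y
      refine Submodule.mem_span_singleton.2
        ⟨x 0 * y 0 + x 1 * y 1 + a * (x 2 * y 2), ?_⟩
      ext k
      have := congrFun ha k
      simp at this
      simp [ofMatrix_apply, Fin.sum_univ_three, hM, ← this]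
      ring)
  simp at hn hn'
  omega

theorem hasDeltaIndex_three (hM : ∀ k j, M k j = M k 0) (h : M.col 0 ≠ 0) :
    HasDeltaIndex (ofMatrix M) [3] := by
  exact hasDeltaIndex_of_columns (f := fun _ => (0 : Fin 1)) (v := fun _ => M.col 0)
    (d := ![3]) (g := fun _ p => Fin.ofNat 3 p) hM (by decide) (fun _ => h)
    (fun k l hkl => absurd (Subsingleton.elim k l) hkl) (by decide) (by decide) (by decide)
    (by simp)

theorem hasDeltaTrace_three (hM : ∀ k j, M k j = M k 0) (h : M.col 0 ≠ 0) {i : F} (K : Kind)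
    (hK : ∀ k, M k 0 = K.coord i k) : HasDeltaTrace i (ofMatrix M) [⟨K, 3⟩] := by
  exact hasDeltaTrace_of_columns (f := fun _ => (0 : Fin 1)) (v := fun _ => M.col 0)
    (d := ![3]) (g := fun _ p => Fin.ofNat 3 p) (K := ![K]) hM (by decide) (fun _ => h)
    (fun k l hkl => absurd (Subsingleton.elim k l) hkl) (by decide) (by decide) (by decide)
    (fun k => by simp [Block.Valid]) (fun k p q => by
      rw [Block.matrix_apply]
      fin_cases k
      fin_cases p <;> simp [hK])
    (by simp)

namespace Entry

omit [Field F] in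
theorem delta_eq_trace (m : Entry F) : m.delta = m.trace.map Block.dim := by
  cases m <;> rfl

theorem matrix_one_eq_matrix_zero (i : F) {m : Entry F} (hm : m.delta = [2, 1]) (k : Fin 3) :
    m.matrix i k 1 = m.matrix i k 0 := by
  cases m <;> simp [delta] at hm <;> fin_cases k <;> rfl

theorem Admissible.hasDeltaTrace {i : F} {m : Entry F} (h : m.Admissible i) :
    HasDeltaTrace i (m.product i) m.trace := by
  have hd := h.1
  have hM := matrix_one_eq_matrix_zero i (m := m)
  cases m
  case A1 | A2 =>
    exact hasDeltaTrace_one_one_one (linearIndependent_col_of_hasDeltaIndex hd) ![.O, .O, .O]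
      (fun j => by fin_cases j <;> simp)
      (fun j => by fin_cases j <;> simp [matrix, Kind.coord]) (by simp)
  case A3 | A4 | A5 =>
    exact hasDeltaTrace_one_one_one (linearIndependent_col_of_hasDeltaIndex hd) ![.O, .O, .E]
      (fun j => by fin_cases j <;> simp)
      (fun j => by fin_cases j <;> simp [matrix, Kind.coord]) (by simp [Kind.rank])
  case A6 =>
    exact hasDeltaTrace_one_one_one (linearIndependent_col_of_hasDeltaIndex hd) ![.O, .E, .E]
      (fun j => by fin_cases j <;> simp)
      (fun j => by fin_cases j <;> simp [matrix, Kind.coord]) (by simp [Kind.rank])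
  case A7 =>
    exact hasDeltaTrace_one_one_one (linearIndependent_col_of_hasDeltaIndex hd) ![.E, .E, .E]
      (fun j => by fin_cases j <;> simp)
      (fun j => by fin_cases j <;> simp [matrix, Kind.coord]) (by simp)
  case E3 =>
    refine hasDeltaTrace_three (fun k j => ?_) (isNondegenerate_ofMatrix_iff.1 hd.2.1 0) .E ?_
    · fin_cases k <;> fin_cases j <;> simp [matrix]
    · intro k
      fin_cases k <;> simp [matrix, Kind.coord]
  case I3 =>
    refine hasDeltaTrace_three (fun k j => ?_) (isNondegenerate_ofMatrix_iff.1 hd.2.1 0) .I ?_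
    · fin_cases k <;> fin_cases j <;> simp [matrix]
    · intro k
      fin_cases k <;> simp [matrix, Kind.coord]
  all_goals
    replace hM := hM rfl
    refine hasDeltaTrace_two_one (i := i) hM (linearIndependent_of_hasDeltaIndex_two_one hM hd)
      _ _ ?_ ?_ ?_ ?_ <;> simp [matrix, Kind.coord]

end Entry

end DimensionThree

/-! ### Index `(1,1,1)`: normal forms under permutation and scaling. -/

section IndexOneOneOne

variable {F : Type*} [Field F]

theorem isomorphic_scale {n : ℕ} (M : Matrix (Fin n) (Fin n) F) {x : Fin n → F}
    (hx : ∀ j, x j ≠ 0) :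
    Isomorphic (ofMatrix M) (ofMatrix (Matrix.of fun k j => x k * M k j / x j ^ 2)) :=
  isomorphic_of_perm (Equiv.refl _) hx fun k j => by
    have := hx j
    simp only [Equiv.refl_apply, Matrix.of_apply]
    field_simp

variable {i : F} {M : Matrix (Fin 3) (Fin 3) F}

section NormalForms

variable [IsAlgClosed F]

theorem exists_ne_zero_pow_eq {n : ℕ} (hn : 0 < n) {a : F} (ha : a ≠ 0) :
    ∃ x, x ≠ 0 ∧ x ^ n = a := by
  obtain ⟨x, hx⟩ := IsAlgClosed.exists_pow_nat_eq a hn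
  refine ⟨x, ?_, hx⟩
  rintro rfl
  exact ha (by rw [← hx, zero_pow hn.ne'])

/-- Being isomorphic to one of the listed algebras of index `(1, 1, 1)`. -/
def HasNormalForm (i : F) (M : Matrix (Fin 3) (Fin 3) F) : Prop :=
  ∃ m : Entry F, m.delta = [1, 1, 1] ∧ Isomorphic (ofMatrix M) (m.product i)

omit [IsAlgClosed F] in
theorem hasNormalForm_of_scale (m : Entry F) (hm : m.delta = [1, 1, 1]) {x : Fin 3 → F}
    (hx : ∀ j, x j ≠ 0) (h : ∀ k j, x k * M k j = x j ^ 2 * m.matrix i k j) :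
    HasNormalForm i M :=
  ⟨m, hm, isomorphic_of_perm (Equiv.refl _) hx h⟩

omit [IsAlgClosed F] in
theorem HasNormalForm.of_submatrix (σ : Equiv.Perm (Fin 3))
    (h : HasNormalForm i (M.submatrix σ σ)) : HasNormalForm i M :=
  h.imp fun _ h => ⟨h.1, (isomorphic_submatrix M σ).trans h.2⟩

theorem hasNormalForm_of_cycle (hd : ∀ j, M j j = 0) (h01 : M 0 1 ≠ 0) (h12 : M 1 2 ≠ 0)
    (h20 : M 2 0 ≠ 0) : HasNormalForm i M := by
  -- The three entries become 1 if `x M₀₁ = y²`, `y M₁₂ = z²` and `z M₂₀ = x²`; eliminating `x` and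
  -- `y` leaves this equation of degree 7.
  obtain ⟨z, hz, hzp⟩ := exists_ne_zero_pow_eq (n := 7) (by norm_num)
    (a := M 0 1 ^ 2 * M 1 2 ^ 4 * M 2 0) (by positivity)
  set y := z ^ 2 / M 1 2 with hy
  set x := y ^ 2 / M 0 1 with hx
  have hy0 : y ≠ 0 := by positivity
  have hx0 : x ≠ 0 := by positivity
  refine hasNormalForm_of_scale (x := ![x, y, z])
    (.A1 (x * M 0 2 / z ^ 2) (y * M 1 0 / x ^ 2) (z * M 2 1 / y ^ 2)) rfl
    (fun j => by fin_cases j <;> assumption) fun k j => ?_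
  fin_cases k <;> fin_cases j <;> simp [Entry.matrix, hd] <;> field_simp
  · rw [hx]; field_simp
  · rw [hy]; field_simp
  · rw [hx, hy]; field_simp; linear_combination -hzp

theorem hasNormalForm_of_row_eq_zero (hd : ∀ j, M j j = 0) (h0 : ∀ j, M 0 j = 0)
    (h12 : M 1 2 ≠ 0) (h20 : M 2 0 ≠ 0) (h21 : M 2 1 ≠ 0) : HasNormalForm i M := by
  -- From `z M₂₁ = y²` and `y M₁₂ = z²`, eliminating `z`; then `x` is free to solve `x² = z M₂₀`.
  obtain ⟨y, hy0, hyp⟩ := exists_ne_zero_pow_eq (n := 3) (by norm_num)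
    (a := M 1 2 * M 2 1 ^ 2) (by positivity)
  set z := y ^ 2 / M 2 1 with hz
  have hz0 : z ≠ 0 := by positivity
  obtain ⟨x, hx0, hx⟩ := exists_ne_zero_pow_eq (n := 2) (by norm_num)
    (a := z * M 2 0) (by positivity)
  refine hasNormalForm_of_scale (x := ![x, y, z]) (.A2 (y * M 1 0 / x ^ 2)) rfl
    (fun j => by fin_cases j <;> assumption) fun k j => ?_
  fin_cases k <;> fin_cases j <;> simp [Entry.matrix, hd, h0] <;> field_simp
  · rw [hz]; field_simp; linear_combination -hyp
  · exact hx.symm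
  · rw [hz]; field_simp

/-- If each of the two oriented 3-cycles of off-diagonal entries contains a zero, the conditions on
columns and on opposite pairs force a whole row to vanish. So either a cycle is free of zeros (`A1`)
or there is a zero row (`A2`). -/
theorem hasNormalForm_of_diag_zero_zero_zero (hd : ∀ j, M j j = 0)
    (hc : ∀ j, ∃ k, M k j ≠ 0) (hp : ∀ j k, j ≠ k → M j k ≠ 0 ∨ M k j ≠ 0) :
    HasNormalForm i M := by
  have hrow : ∀ r, (∀ j, M r j = 0) → HasNormalForm i M := by
    intro r hr
    apply HasNormalForm.of_submatrix (Equiv.swap 0 r)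
    -- In column `b` the diagonal entry and the entry in the zero row `r` vanish, so the third one
    -- cannot.
    have key : ∀ a b, a ≠ b → b ≠ r → (∀ c, c ≠ a → c ≠ b → c = r) → M a b ≠ 0 := by
      intro a b hab hb hr'
      obtain ⟨k, hk⟩ := hc b
      have hkb : k ≠ b := by rintro rfl; exact hk (hd k)
      by_cases hka : k = a
      · rwa [hka] at hk
      · rw [hr' k hka hkb, hr] at hk; exact absurd rfl hk
    refine hasNormalForm_of_row_eq_zero (by simp [hd]) (by simp [hr]) ?_ ?_ ?_
    · fin_cases r <;> simp [Equiv.swap_apply_def] <;> apply key <;> decide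
    · have := hp (Equiv.swap 0 r 2) r (by fin_cases r <;> decide)
      simpa [hr] using this
    · fin_cases r <;> simp [Equiv.swap_apply_def] <;> apply key <;> decide
  by_cases h1 : M 0 1 ≠ 0 ∧ M 1 2 ≠ 0 ∧ M 2 0 ≠ 0
  · exact hasNormalForm_of_cycle hd h1.1 h1.2.1 h1.2.2
  by_cases h2 : M 1 0 ≠ 0 ∧ M 0 2 ≠ 0 ∧ M 2 1 ≠ 0
  · exact .of_submatrix (Equiv.swap 0 1) (hasNormalForm_of_cycle (by simp [hd])
      (by simpa using h2.1) (by simpa [Equiv.swap_apply_def] using h2.2.1)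
      (by simpa [Equiv.swap_apply_def] using h2.2.2))
  have : ∃ r, ∀ j, M r j = 0 := by
    have a1 := hp 0 1 (by decide)
    have a2 := hp 0 2 (by decide)
    have a3 := hp 1 2 (by decide)
    have b1 : M 1 0 ≠ 0 ∨ M 2 0 ≠ 0 := by simpa [Fin.exists_fin_succ, hd] using hc 0
    have b2 : M 0 1 ≠ 0 ∨ M 2 1 ≠ 0 := by simpa [Fin.exists_fin_succ, hd] using hc 1
    have b3 : M 0 2 ≠ 0 ∨ M 1 2 ≠ 0 := by simpa [Fin.exists_fin_succ, hd] using hc 2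
    have : (M 0 1 = 0 ∧ M 0 2 = 0) ∨ (M 1 0 = 0 ∧ M 1 2 = 0) ∨ (M 2 0 = 0 ∧ M 2 1 = 0) := by
      clear hrow hc hp hd
      grind
    rcases this with h | h | h
    · exact ⟨0, by simp [Fin.forall_fin_succ, hd, h]⟩
    · exact ⟨1, by simp [Fin.forall_fin_succ, hd, h]⟩
    · exact ⟨2, by simp [Fin.forall_fin_succ, hd, h]⟩
  obtain ⟨r, hr⟩ := this
  exact hrow r hr

theorem hasNormalForm_of_diag_zero_zero_one_of_ne_zero (h00 : M 0 0 = 0) (h11 : M 1 1 = 0)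
    (h22 : M 2 2 = 1) (hc0 : M 2 0 = 0 → M 1 0 ≠ 0) (h21 : M 2 1 ≠ 0) :
    HasNormalForm i M := by
  obtain ⟨y, hy0, hy⟩ := exists_ne_zero_pow_eq (n := 2) (by norm_num) h21
  by_cases h20 : M 2 0 = 0
  · have h10 := hc0 h20
    obtain ⟨x, hx0, hx⟩ := exists_ne_zero_pow_eq (n := 2) (by norm_num) (mul_ne_zero hy0 h10)
    refine hasNormalForm_of_scale (x := ![x, y, 1]) (.A4 (x * M 0 1 / y ^ 2) (x * M 0 2) (y * M 1 2))
      rfl (fun j => by fin_cases j <;> simp [hx0, hy0]) fun k j => ?_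
    fin_cases k <;> fin_cases j <;> simp [Entry.matrix, h00, h11, h22, h20, hx, hy]
    field_simp
  · obtain ⟨x, hx0, hx⟩ := exists_ne_zero_pow_eq (n := 2) (by norm_num) h20
    refine hasNormalForm_of_scale (x := ![x, y, 1])
      (.A3 (x * M 0 1 / y ^ 2) (x * M 0 2) (y * M 1 0 / x ^ 2) (y * M 1 2))
      rfl (fun j => by fin_cases j <;> simp [hx0, hy0]) fun k j => ?_
    fin_cases k <;> fin_cases j <;> simp [Entry.matrix, h00, h11, h22, hx, hy] <;> field_simp

theorem hasNormalForm_of_diag_zero_zero_one (h00 : M 0 0 = 0) (h11 : M 1 1 = 0)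
    (h22 : M 2 2 = 1) (hc0 : M 2 0 = 0 → M 1 0 ≠ 0) (hc1 : M 2 1 = 0 → M 0 1 ≠ 0) :
    HasNormalForm i M := by
  by_cases h21 : M 2 1 = 0
  · by_cases h20 : M 2 0 = 0
    · have h10 := hc0 h20
      have h01 := hc1 h21
      -- Solves `y M₁₀ = x²` and `x M₀₁ = y²` after eliminating `y`.
      obtain ⟨x, hx0, hx⟩ := exists_ne_zero_pow_eq (n := 3) (by norm_num)
        (a := M 0 1 * M 1 0 ^ 2) (by positivity)
      set y := x ^ 2 / M 1 0 with hy
      have hy0 : y ≠ 0 := by positivity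
      refine hasNormalForm_of_scale (x := ![x, y, 1]) (.A5 (x * M 0 2) (y * M 1 2)) rfl
        (fun j => by fin_cases j <;> simp [hx0, hy0]) fun k j => ?_
      fin_cases k <;> fin_cases j <;> simp [Entry.matrix, h00, h11, h22, h20, h21]
      · rw [hy]; field_simp; linear_combination -hx
      · rw [hy]; field_simp
    · exact .of_submatrix (Equiv.swap 0 1) (hasNormalForm_of_diag_zero_zero_one_of_ne_zero
        (by simpa) (by simpa) (by simpa [Equiv.swap_apply_def])
        (by simpa [Equiv.swap_apply_def] using hc1) (by simpa [Equiv.swap_apply_def]))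
  · exact hasNormalForm_of_diag_zero_zero_one_of_ne_zero h00 h11 h22 hc0 h21

theorem hasNormalForm_of_diag_zero_one_one_of_ne_zero (h00 : M 0 0 = 0) (h11 : M 1 1 = 1)
    (h22 : M 2 2 = 1) (h10 : M 1 0 ≠ 0) : HasNormalForm i M := by
  obtain ⟨x, hx0, hx⟩ := exists_ne_zero_pow_eq (n := 2) (by norm_num) h10
  refine hasNormalForm_of_scale (x := ![x, 1, 1])
    (.A6 (x * M 0 1) (x * M 0 2) (M 1 2) (M 2 0 / x ^ 2) (M 2 1))
    rfl (fun j => by fin_cases j <;> simp [hx0]) fun k j => ?_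
  fin_cases k <;> fin_cases j <;> simp [Entry.matrix, h00, h11, h22, hx]
  field_simp

theorem hasNormalForm_of_diag_zero_one_one (h00 : M 0 0 = 0) (h11 : M 1 1 = 1)
    (h22 : M 2 2 = 1) (hc : M 1 0 = 0 → M 2 0 ≠ 0) : HasNormalForm i M := by
  by_cases h10 : M 1 0 = 0
  · exact .of_submatrix (Equiv.swap 1 2) (hasNormalForm_of_diag_zero_one_one_of_ne_zero
      (by simpa [Equiv.swap_apply_def]) (by simpa) (by simpa)
      (by simpa [Equiv.swap_apply_def] using hc h10))
  · exact hasNormalForm_of_diag_zero_one_one_of_ne_zero h00 h11 h22 h10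

omit [IsAlgClosed F] in
theorem hasNormalForm_of_diag_one_one_one (h : ∀ j, M j j = 1) : HasNormalForm i M := by
  refine hasNormalForm_of_scale (x := 1)
    (.A7 (M 0 1) (M 0 2) (M 1 0) (M 1 2) (M 2 0) (M 2 1)) rfl (by simp) fun k j => ?_
  fin_cases k <;> fin_cases j <;> simp [Entry.matrix, h]

-- Sorting brings the zero diagonal entries first; scaling `e_j` by a nonzero diagonal entry turns
-- that entry into 1.
omit [IsAlgClosed F] in
theorem exists_isomorphic_sorted_diag (M : Matrix (Fin 3) (Fin 3) F) :
    ∃ M' : Matrix (Fin 3) (Fin 3) F, Isomorphic (ofMatrix M) (ofMatrix M') ∧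
      ((M' 0 0 = 0 ∧ M' 1 1 = 0 ∧ M' 2 2 = 0) ∨ (M' 0 0 = 0 ∧ M' 1 1 = 0 ∧ M' 2 2 = 1) ∨
      (M' 0 0 = 0 ∧ M' 1 1 = 1 ∧ M' 2 2 = 1) ∨ (M' 0 0 = 1 ∧ M' 1 1 = 1 ∧ M' 2 2 = 1)) := by
  classical
  set σ := Tuple.sort fun j => if M j j = 0 then 0 else 1
  set N := M.submatrix σ σ
  have hN : ∀ j l, j ≤ l → N l l = 0 → N j j = 0 := by
    intro j l hjl hl
    have := Tuple.monotone_sort (fun j => if M j j = 0 then 0 else 1) hjl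
    by_contra hj
    simp only [N, Matrix.submatrix_apply] at hl hj
    simp only [Function.comp_apply] at this
    rw [if_neg hj, if_pos hl] at this
    omega
  refine ⟨_, (isomorphic_submatrix M σ).trans (isomorphic_scale N
    (x := fun j => if N j j = 0 then 1 else N j j) (fun j => by split_ifs <;> simp_all)), ?_⟩
  have h1 : ∀ j, N j j ≠ 0 → N j j * N j j / N j j ^ 2 = 1 := fun j hj => by field_simp
  have h10 := hN 0 1 (by decide)
  have h21 := hN 1 2 (by decide)
  clear_value N
  by_cases ha : N 0 0 = 0 <;> by_cases hb : N 1 1 = 0 <;> by_cases hc : N 2 2 = 0 <;>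
    simp_all

theorem hasNormalForm_of_hasDeltaIndex (i : F) (h : HasDeltaIndex (ofMatrix M) [1, 1, 1]) :
    HasNormalForm i M := by
  obtain ⟨N, hMN, hN⟩ := exists_isomorphic_sorted_diag M
  suffices HasNormalForm i N from this.imp fun _ h => ⟨h.1, hMN.trans h.2⟩
  have hd := h.of_isomorphic hMN
  have hLI := linearIndependent_col_of_hasDeltaIndex hd
  have hcol : ∀ j, ∃ k, N k j ≠ 0 := by
    intro j
    have := isNondegenerate_ofMatrix_iff.1 hd.2.1 j
    contrapose! this
    exact funext this
  -- Two columns supported in the same single row `m` are proportional.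
  have hind : ∀ j l, j ≠ l → ∀ m, (∀ k, k ≠ m → N k j = 0 ∧ N k l = 0) → False := by
    intro j l hjl m hm
    have := LinearIndependent.pair_iff.1 (hLI j l hjl) (N m l) (-N m j) (by
      ext k
      by_cases hk : k = m
      · subst hk; simp; ring
      · simp [hm k hk])
    obtain ⟨k, hk⟩ := hcol l
    by_cases hkm : k = m
    · subst hkm; exact hk this.1
    · exact hk (hm k hkm).2
  rcases hN with ⟨h0, h1, h2⟩ | ⟨h0, h1, h2⟩ | ⟨h0, h1, h2⟩ | ⟨h0, h1, h2⟩
  · have hdiag : ∀ j, N j j = 0 := by simp [Fin.forall_fin_succ, h0, h1, h2]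
    refine hasNormalForm_of_diag_zero_zero_zero hdiag hcol fun j l hjl => ?_
    by_contra! H
    obtain ⟨m, hm⟩ : ∃ m, ∀ k, k ≠ m → k = j ∨ k = l := by
      clear H
      revert j l
      decide
    refine hind j l hjl m fun k hk => ?_
    rcases hm k hk with rfl | rfl <;> simp [hdiag, H]
  · refine hasNormalForm_of_diag_zero_zero_one h0 h1 h2 (fun h20 h10 => ?_) fun h21 h01 => ?_
    · obtain ⟨k, hk⟩ := hcol 0
      fin_cases k <;> simp_all
    · obtain ⟨k, hk⟩ := hcol 1
      fin_cases k <;> simp_all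
  · refine hasNormalForm_of_diag_zero_one_one h0 h1 h2 fun h10 h20 => ?_
    obtain ⟨k, hk⟩ := hcol 0
    fin_cases k <;> simp_all
  · exact hasNormalForm_of_diag_one_one_one (by simp [Fin.forall_fin_succ, h0, h1, h2])

end NormalForms

/-! ### Index `(1,1,1)`: isomorphisms and separation of the families. -/

namespace Entry

theorem diag_eq_zero_or_one (i : F) {m : Entry F} (hm : m.delta = [1, 1, 1]) (j : Fin 3) :
    m.matrix i j j = 0 ∨ m.matrix i j j = 1 := by
  cases m <;> simp [delta] at hm <;> fin_cases j <;> simp [matrix]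

/-- Every isomorphism between two listed algebras of index `(1, 1, 1)` permutes the basis vectors
up to scalars. -/
theorem exists_perm_of_isAlgIso {m m' : Entry F} (hm' : m'.Admissible i)
    (hd' : m'.delta = [1, 1, 1])
    {φ : (Fin 3 → F) ≃ₗ[F] (Fin 3 → F)} (hφ : IsAlgIso (m.product i) (m'.product i) φ) :
    ∃ (σ : Equiv.Perm (Fin 3)) (x : Fin 3 → F), (∀ j, x j ≠ 0) ∧
      (∀ j, m.matrix i j j = 1 → x j = 1) ∧
      (∀ j, φ (Pi.single j 1) = x j • Pi.single (σ j) 1) ∧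
      ∀ k j, x k * m.matrix i k j = x j ^ 2 * m'.matrix i (σ k) (σ j) := by
  obtain ⟨σ, x, hx, hφx, hrel⟩ := IsAlgIso.exists_perm hφ
    (linearIndependent_col_of_hasDeltaIndex (hd' ▸ hm'.1))
  refine ⟨σ, x, hx, fun j hj => ?_, hφx, hrel⟩
  have h1 := hrel j j
  rw [hj] at h1
  rcases diag_eq_zero_or_one i hd' (σ j) with h | h
  · rw [h, mul_one, mul_zero] at h1
    exact absurd h1 (hx j)
  · rw [h, pow_two, mul_one, mul_one] at h1
    exact (mul_left_cancel₀ (hx j) (by rw [← h1, mul_one]))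

theorem permutationRelated_of_isomorphic {m m' : Entry F} (hm' : m'.Admissible i)
    (hd' : m'.delta = [1, 1, 1])
    (h : Isomorphic (m.product i) (m'.product i)) :
    PermutationRelated (m.matrix i) (m'.matrix i) := by
  obtain ⟨φ, hφ⟩ := h
  obtain ⟨σ, x, hx, hx1, -, hrel⟩ := exists_perm_of_isAlgIso hm' hd' hφ
  exact ⟨σ, x, hx, hx1, hrel⟩

end Entry

theorem PermutationRelated.isomorphic {M M' : Matrix (Fin 3) (Fin 3) F}
    (h : PermutationRelated M M') : Isomorphic (ofMatrix M) (ofMatrix M') := by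
  obtain ⟨σ, x, hx, -, hrel⟩ := h
  exact isomorphic_of_perm σ hx hrel

/-- The positions of the zeros, up to a simultaneous permutation of rows and columns, are the
invariant that separates the families of equal trace. -/
theorem PermutationRelated.exists_zero_iff {M M' : Matrix (Fin 3) (Fin 3) F}
    (h : PermutationRelated M M') :
    ∃ σ : Equiv.Perm (Fin 3), ∀ k j, M k j = 0 ↔ M' (σ k) (σ j) = 0 := by
  obtain ⟨σ, x, hx, -, hrel⟩ := h
  refine ⟨σ, fun k j => ⟨fun h => ?_, fun h => ?_⟩⟩
  · have := hrel k j
    rw [h, mul_zero, eq_comm, mul_eq_zero] at this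
    exact this.resolve_left (pow_ne_zero 2 (hx j))
  · have := hrel k j
    rw [h, mul_zero, mul_eq_zero] at this
    exact this.resolve_left (hx k)

namespace Entry

/-- `A2` has a zero row, whereas each row of `A1` contains an entry 1. -/
theorem not_permutationRelated_A1_A2 (α β γ α' : F) :
    ¬ PermutationRelated ((A1 α β γ).matrix i) ((A2 α').matrix i) := by
  intro h
  obtain ⟨σ, hσ⟩ := h.exists_zero_iff
  obtain ⟨r, hr⟩ := σ.surjective 0
  have : ∀ j, (A1 α β γ).matrix i r j = 0 := fun j => by
    rw [hσ, hr]
    generalize σ j = l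
    fin_cases l <;> rfl
  fin_cases r
  · simpa [matrix] using this 1
  · simpa [matrix] using this 2
  · simpa [matrix] using this 0

/-- In the trace `(O, O, E)`, the number of zeros in the last row is an invariant. -/
theorem exists_last_row_perm {m m' : Entry F} (h : PermutationRelated (m.matrix i) (m'.matrix i))
    (h0 : m'.matrix i 0 0 = 0) (h1 : m'.matrix i 1 1 = 0) (h2 : m.matrix i 2 2 ≠ 0) :
    ∃ σ : Equiv.Perm (Fin 3), σ 2 = 2 ∧ ∀ j, m.matrix i 2 j = 0 ↔ m'.matrix i 2 (σ j) = 0 := by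
  obtain ⟨σ, hσ⟩ := h.exists_zero_iff
  -- The last diagonal entry is the only one in `m'` that can be nonzero.
  have h22 : σ 2 = 2 := by
    rw [ne_eq, hσ] at h2
    generalize σ 2 = l at h2
    fin_cases l
    · exact absurd h0 h2
    · exact absurd h1 h2
    · rfl
  exact ⟨σ, h22, fun j => by rw [hσ, h22]⟩

theorem not_permutationRelated_A3 (α β γ ε : F) {m : Entry F} (h0 : m.matrix i 0 0 = 0)
    (h1 : m.matrix i 1 1 = 0) (h2 : m.matrix i 2 0 = 0) :
    ¬ PermutationRelated ((A3 α β γ ε).matrix i) (m.matrix i) := by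
  intro h
  obtain ⟨σ, -, hσ⟩ := exists_last_row_perm h h0 h1 (by simp [matrix])
  obtain ⟨j, hj⟩ := σ.surjective 0
  have h3 := (hσ j).2 (by rw [hj, h2])
  fin_cases j <;> simp [matrix] at h3

theorem not_permutationRelated_A4_A5 (α β γ α' β' : F) :
    ¬ PermutationRelated ((A4 α β γ).matrix i) ((A5 α' β').matrix i) := by
  intro h
  obtain ⟨σ, hσ2, hσ⟩ := exists_last_row_perm h rfl rfl (by simp [matrix])
  have h1 : σ 1 ≠ 2 := by rw [← hσ2]; exact σ.injective.ne (by decide)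
  have h3 := (hσ 1).2 (by
    generalize σ 1 = l at h1
    fin_cases l <;> simp [matrix] at h1 ⊢)
  simp [matrix] at h3

theorem coincide_of_delta_eq_one_one_one {m m' : Entry F} (hm : m.Admissible i)
    (hm' : m'.Admissible i) (hd : m.delta = [1, 1, 1]) (ht : m.trace = m'.trace)
    (h : Isomorphic (m.product i) (m'.product i)) : Coincide i m m' := by
  have hd' : m'.delta = [1, 1, 1] := by rw [delta_eq_trace, ← ht, ← delta_eq_trace, hd]
  have hp := permutationRelated_of_isomorphic hm' hd' h
  have hp' := permutationRelated_of_isomorphic hm hd h.symm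
  cases m <;> simp [delta] at hd <;> cases m' <;> simp [trace] at ht
  case A1.A1 | A2.A2 | A3.A3 | A4.A4 | A5.A5 | A6.A6 | A7.A7 => constructor; exact hp
  case A1.A2 => exact absurd hp (not_permutationRelated_A1_A2 _ _ _ _)
  case A2.A1 => exact absurd hp' (not_permutationRelated_A1_A2 _ _ _ _)
  case A3.A4 | A3.A5 => exact absurd hp (not_permutationRelated_A3 _ _ _ _ rfl rfl rfl)
  case A4.A3 | A5.A3 => exact absurd hp' (not_permutationRelated_A3 _ _ _ _ rfl rfl rfl)
  case A4.A5 => exact absurd hp (not_permutationRelated_A4_A5 _ _ _ _ _)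
  case A5.A4 => exact absurd hp' (not_permutationRelated_A4_A5 _ _ _ _ _)

end Entry
end IndexOneOneOne

/-! ### Index `(2,1)`: isomorphisms as scalings of isotropic coordinates. -/

section IndexTwoOne

/-- For two orthogonal vectors of equal length, Lagrange's identity `(pt - qr)² + (pr + qt)² = (p² +
q²)(r² + t²)` gives the determinant up to sign; the sign selects rotation or reflection type. -/
theorem planar_similitude {F : Type*} [Field F] {p q r t : F} (h : p * r + q * t = 0)
    (h' : p * p + q * q = r * r + t * t) (h0 : p * p + q * q ≠ 0) :
    (r = -q ∧ t = p) ∨ (r = q ∧ t = -p) := by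
  have hD : (p * t - q * r) ^ 2 = (p * p + q * q) ^ 2 := by
    linear_combination -(p * p + q * q) * h' - (p * r + q * t) * h
  rcases sq_eq_sq_iff_eq_or_eq_neg.1 hD with hD | hD
  · exact .inl ⟨mul_left_cancel₀ h0 (by linear_combination p * h - q * hD),
      mul_left_cancel₀ h0 (by linear_combination q * h + p * hD)⟩
  · exact .inr ⟨mul_left_cancel₀ h0 (by linear_combination p * h - q * hD),
      mul_left_cancel₀ h0 (by linear_combination q * h + p * hD)⟩

/-- Coordinates of the squares `v = e₁² = e₂²` and `w = e₃²` with respect to the isotropic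
coordinates `x₁ + i x₂`, `x₁ - i x₂`, `x₃`. -/
@[ext] structure IsotropicCoords (F : Type*) where
  P : F
  Q : F
  a : F
  R : F
  S : F
  b : F

namespace IsotropicCoords

variable {F : Type*} [Field F]

/-- The isotropic coordinates of the first and the third column of a matrix. -/
def ofMat (i : F) (M : Matrix (Fin 3) (Fin 3) F) : IsotropicCoords F where
  P := M 0 0 + i * M 1 0
  Q := M 0 0 - i * M 1 0
  a := M 2 0
  R := M 0 2 + i * M 1 2
  S := M 0 2 - i * M 1 2
  b := M 2 2

/-- The effect of `x₂ ↦ - x₂`. -/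
def swap (X : IsotropicCoords F) : IsotropicCoords F := ⟨X.Q, X.P, X.a, X.S, X.R, X.b⟩

/-- Equivalence under the maps that scale the three isotropic coordinates by `s`, `t`, `c`. -/
def Rel (X Y : IsotropicCoords F) : Prop :=
  ∃ s t c, s ≠ 0 ∧ t ≠ 0 ∧ c ≠ 0 ∧ X.P = t * Y.P ∧ X.Q = s * Y.Q ∧ c * X.a = s * t * Y.a ∧
    s * X.R = c ^ 2 * Y.R ∧ t * X.S = c ^ 2 * Y.S ∧ X.b = c * Y.b

variable {i : F} (hi : i ^ 2 = -1) {M M' : Matrix (Fin 3) (Fin 3) F}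
  (hM : ∀ k, M k 1 = M k 0) (hM' : ∀ k, M' k 1 = M' k 0)
include hM hM'

include hi in
theorem isomorphic_of_rel [CharZero F] (h : Rel (ofMat i M) (ofMat i M')) :
    Isomorphic (ofMatrix M) (ofMatrix M') := by
  have hi0 : i ≠ 0 := by rintro rfl; norm_num at hi
  obtain ⟨s, t, c, hs, ht, hc, h1, h2, h3, h4, h5, h6⟩ := h
  simp only [ofMat] at h1 h2 h3 h4 h5 h6
  -- The plane map `(A, -C; C, A)` multiplies `x₁ + i x₂` by `A + i C` and `x₁ - i x₂` by `A - i C`.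
  obtain ⟨A, C, rfl, rfl⟩ : ∃ A C, s = A + i * C ∧ t = A - i * C :=
    ⟨(s + t) / 2, (s - t) / (2 * i), by field_simp; ring, by field_simp; ring⟩
  have key : ∀ {x y : F}, x + i * y = 0 → x - i * y = 0 → x = 0 ∧ y = 0 := by
    intro x y h1 h2
    have hx : x = 0 := by linear_combination (h1 + h2) / 2
    rw [hx, zero_add] at h1
    exact ⟨hx, (mul_eq_zero.1 h1).resolve_left hi0⟩
  have happ : ∀ x : Fin 3 → F, Matrix.toLin' !![A, -C, 0; C, A, 0; 0, 0, c] x =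
      ![A * x 0 - C * x 1, C * x 0 + A * x 1, c * x 2] := by
    intro x
    rw [Matrix.toLin'_apply]
    ext k
    fin_cases k <;> simp [Matrix.mulVec, dotProduct, Fin.sum_univ_three]
    ring
  refine ⟨LinearEquiv.ofInjectiveEndo (Matrix.toLin' !![A, -C, 0; C, A, 0; 0, 0, c]) ?_,
    fun x y => ?_⟩
  · rw [injective_iff_map_eq_zero]
    intro x hx
    rw [happ] at hx
    have e0 := congrFun hx 0
    have e1 := congrFun hx 1
    have e2 := congrFun hx 2
    simp at e0 e1 e2
    have hp : x 0 + i * x 1 = 0 := by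
      apply (mul_eq_zero.1 (?_ : (A + i * C) * (x 0 + i * x 1) = 0)).resolve_left hs
      linear_combination e0 + i * e1 + C * x 1 * hi
    have hq : x 0 - i * x 1 = 0 := by
      apply (mul_eq_zero.1 (?_ : (A - i * C) * (x 0 - i * x 1) = 0)).resolve_left ht
      linear_combination e0 - i * e1 + C * x 1 * hi
    obtain ⟨h0, h1⟩ := key hp hq
    ext k
    fin_cases k
    · exact h0
    · exact h1
    · exact e2.resolve_left hc
  · simp only [LinearEquiv.coe_ofInjectiveEndo, happ]
    -- The two plane coordinates of the multiplicativity equation are checked through their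
    -- isotropic combinations.
    have hX := @key
      (A * ofMatrix M x y 0 - C * ofMatrix M x y 1 -
        ofMatrix M' ![A * x 0 - C * x 1, C * x 0 + A * x 1, c * x 2]
          ![A * y 0 - C * y 1, C * y 0 + A * y 1, c * y 2] 0)
      (C * ofMatrix M x y 0 + A * ofMatrix M x y 1 -
        ofMatrix M' ![A * x 0 - C * x 1, C * x 0 + A * x 1, c * x 2]
          ![A * y 0 - C * y 1, C * y 0 + A * y 1, c * y 2] 1)
      (by
        simp [ofMatrix_apply, Fin.sum_univ_three, hM, hM']
        linear_combination (A + i * C) * (x 0 * y 0 + x 1 * y 1) * h1 + x 2 * y 2 * h4 -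
          (C * M 1 0 * (x 0 * y 0 + x 1 * y 1) + C * M 1 2 * (x 2 * y 2) +
            C ^ 2 * (M' 0 0 + i * M' 1 0) * (x 0 * y 0 + x 1 * y 1)) * hi)
      (by
        simp [ofMatrix_apply, Fin.sum_univ_three, hM, hM']
        linear_combination (A - i * C) * (x 0 * y 0 + x 1 * y 1) * h2 + x 2 * y 2 * h5 -
          (C * M 1 0 * (x 0 * y 0 + x 1 * y 1) + C * M 1 2 * (x 2 * y 2) +
            C ^ 2 * (M' 0 0 - i * M' 1 0) * (x 0 * y 0 + x 1 * y 1)) * hi)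
    ext k
    fin_cases k
    · exact sub_eq_zero.1 hX.1
    · exact sub_eq_zero.1 hX.2
    · simp [ofMatrix_apply, Fin.sum_univ_three, hM, hM']
      linear_combination (x 0 * y 0 + x 1 * y 1) * h3 + c * (x 2 * y 2) * h6 -
        (x 0 * y 0 + x 1 * y 1) * M' 2 0 * C ^ 2 * hi

include hi in
theorem isomorphic_of_rel_or [CharZero F]
    (h : Rel (ofMat i M) (ofMat i M') ∨ Rel (ofMat i M).swap (ofMat i M')) :
    Isomorphic (ofMatrix M) (ofMatrix M') := by
  rcases h with h | h
  · exact isomorphic_of_rel hi hM hM' h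
  · have hx : ∀ j, (![1, -1, 1] : Fin 3 → F) j ≠ 0 := by
      intro j; fin_cases j <;> simp
    refine (isomorphic_scale M hx).trans (isomorphic_of_rel hi (fun k => ?_) hM' ?_)
    · simp [hM]
    · convert h using 1
      ext <;> simp [ofMat, swap, sub_eq_add_neg]

/-- Since the two columns of `M'` are independent, their coefficients in `φ (x y) = φ x φ y` can be
compared separately. This makes the matrix `G` of `φ` block diagonal with a similitude as plane
block. -/
theorem rel_or_of_isAlgIso (hi : i ^ 2 = -1) (hN : IsNondegenerate (ofMatrix M))
    (hLI : LinearIndependent F ![M'.col 0, M'.col 2])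
    {φ : (Fin 3 → F) ≃ₗ[F] (Fin 3 → F)} (hφ : IsAlgIso (ofMatrix M) (ofMatrix M') φ) :
    Rel (ofMat i M) (ofMat i M') ∨ Rel (ofMat i M).swap (ofMat i M') := by
  obtain ⟨G, hG⟩ : ∃ G : Matrix (Fin 3) (Fin 3) F, ∀ j k, φ (Pi.single j 1) k = G k j :=
    ⟨fun k j => φ (Pi.single j 1) k, fun _ _ => rfl⟩
  have hφG : ∀ x k, φ x k = ∑ j, G k j * x j := by
    intro x k
    conv_lhs => rw [← (Pi.basisFun F (Fin 3)).sum_repr x]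
    simp [Finset.sum_apply, hG, mul_comm]
  have hmul : ∀ x y : Fin 3 → F, ofMatrix M' x y =
      (x 0 * y 0 + x 1 * y 1) • M'.col 0 + (x 2 * y 2) • M'.col 2 := by
    intro x y
    ext k
    simp [ofMatrix_apply, Fin.sum_univ_three, hM']
    ring
  rw [LinearIndependent.pair_iff] at hLI
  have horth : ∀ j l, j ≠ l → G 0 j * G 0 l + G 1 j * G 1 l = 0 ∧ G 2 j * G 2 l = 0 := by
    intro j l hjl
    have h := hφ (Pi.single j 1) (Pi.single l 1)
    rw [ofMatrix_apply_single, Pi.single_eq_of_ne hjl.symm, zero_smul, map_zero, hmul] at h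
    simp only [hG] at h
    exact hLI _ _ h.symm
  have hsq : ∀ j, φ (M.col j) =
      (G 0 j * G 0 j + G 1 j * G 1 j) • M'.col 0 + (G 2 j * G 2 j) • M'.col 2 := by
    intro j
    have h := hφ (Pi.single j 1) (Pi.single j 1)
    rw [ofMatrix_single_single, hmul] at h
    simpa only [hG] using h
  have h01 : G 0 0 * G 0 0 + G 1 0 * G 1 0 = G 0 1 * G 0 1 + G 1 1 * G 1 1 ∧
      G 2 0 * G 2 0 = G 2 1 * G 2 1 := by
    have h : M.col 1 = M.col 0 := funext hM
    have h' := (hsq 0).symm.trans ((congrArg φ h.symm).trans (hsq 1))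
    have := hLI (G 0 0 * G 0 0 + G 1 0 * G 1 0 - (G 0 1 * G 0 1 + G 1 1 * G 1 1))
      (G 2 0 * G 2 0 - G 2 1 * G 2 1) (by
        rw [sub_smul, sub_smul]
        linear_combination (exp := 1) h')
    exact ⟨sub_eq_zero.1 this.1, sub_eq_zero.1 this.2⟩
  -- `G₂₀` and `G₂₁` have product 0 and equal squares.
  have h20 : G 2 0 = 0 := by grind
  have h21 : G 2 1 = 0 := by grind
  have h22 : G 2 2 ≠ 0 := by
    intro h0
    have := hφG (φ.symm (Pi.single 2 1)) 2
    simp [Fin.sum_univ_three, h20, h21, h0] at this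
  -- Otherwise `φ` would kill the nonzero column `M.col 0`.
  have hlam : G 0 0 * G 0 0 + G 1 0 * G 1 0 ≠ 0 := by
    intro h0
    have := hsq 0
    rw [h0, h20, mul_zero, zero_smul, zero_smul, add_zero, LinearEquiv.map_eq_zero_iff] at this
    exact isNondegenerate_ofMatrix_iff.1 hN 0 this
  have ho1 := (horth 0 1 (by decide)).1
  have ho2 := (horth 0 2 (by decide)).1
  have ho3 := (horth 1 2 (by decide)).1
  have hv : ∀ k, G k 0 * M 0 0 + G k 1 * M 1 0 + G k 2 * M 2 0 =
      (G 0 0 * G 0 0 + G 1 0 * G 1 0) * M' k 0 := by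
    intro k
    have := congrFun (hsq 0) k
    rw [hφG] at this
    simpa [Fin.sum_univ_three, h20] using this
  have hw : ∀ k, G k 0 * M 0 2 + G k 1 * M 1 2 + G k 2 * M 2 2 =
      (G 0 2 * G 0 2 + G 1 2 * G 1 2) * M' k 0 + G 2 2 * G 2 2 * M' k 2 := by
    intro k
    have := congrFun (hsq 2) k
    rw [hφG] at this
    simpa [Fin.sum_univ_three] using this
  -- This plane vector is orthogonal to two orthogonal vectors of nonzero length, which span the
  -- plane.
  have h02 : G 0 2 = 0 ∧ G 1 2 = 0 := by
    clear hφG hsq hv hw hmul hLI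
    grind
  have hst : (G 0 0 + i * G 1 0) * (G 0 0 - i * G 1 0) = G 0 0 * G 0 0 + G 1 0 * G 1 0 := by
    linear_combination -G 1 0 ^ 2 * hi
  rw [← hst] at hlam
  have hs := left_ne_zero_of_mul hlam
  have ht := right_ne_zero_of_mul hlam
  have hv0 := hv 0
  have hv1 := hv 1
  have hv2 := hv 2
  have hw0 := hw 0
  have hw1 := hw 1
  have hw2 := hw 2
  simp only [h20, h21, h02, mul_zero, zero_mul, zero_add, add_zero] at hv0 hv1 hv2 hw0 hw1 hw2
  have hb : M 2 2 = G 2 2 * M' 2 2 := mul_left_cancel₀ h22 (by rw [hw2, mul_assoc])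
  have hG01 : (G 0 1 = -G 1 0 ∧ G 1 1 = G 0 0) ∨ (G 0 1 = G 1 0 ∧ G 1 1 = -G 0 0) := by
    exact planar_similitude ho1 h01.1 (hst ▸ hlam)
  rcases hG01 with ⟨h1, h2⟩ | ⟨h1, h2⟩ <;> rw [h1] at hv0 hw0 <;> rw [h2] at hv1 hw1
  · refine .inl ⟨_, _, _, hs, ht, h22, mul_left_cancel₀ hs ?_, mul_left_cancel₀ ht ?_, ?_, ?_, ?_,
      hb⟩ <;> simp only [ofMat]
    · linear_combination hv0 + i * hv1 + G 1 0 * M 1 0 * hi - (M' 0 0 + i * M' 1 0) * hst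
    · linear_combination hv0 - i * hv1 + G 1 0 * M 1 0 * hi - (M' 0 0 - i * M' 1 0) * hst
    · linear_combination hv2 - M' 2 0 * hst
    · linear_combination hw0 + i * hw1 + G 1 0 * M 1 2 * hi
    · linear_combination hw0 - i * hw1 + G 1 0 * M 1 2 * hi
  · refine .inr ⟨_, _, _, hs, ht, h22, mul_left_cancel₀ hs ?_, mul_left_cancel₀ ht ?_, ?_, ?_, ?_,
      hb⟩ <;> simp only [ofMat, swap]
    · linear_combination hv0 + i * hv1 - G 1 0 * M 1 0 * hi - (M' 0 0 + i * M' 1 0) * hst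
    · linear_combination hv0 - i * hv1 - G 1 0 * M 1 0 * hi - (M' 0 0 - i * M' 1 0) * hst
    · linear_combination hv2 - M' 2 0 * hst
    · linear_combination hw0 + i * hw1 - G 1 0 * M 1 2 * hi
    · linear_combination hw0 - i * hw1 - G 1 0 * M 1 2 * hi

end IsotropicCoords
end IndexTwoOne

/-! ### Index `(2,1)`: normal forms and coincidences. -/

section IndexTwoOneList

variable {F : Type*} [Field F] {i : F}

namespace Entry

/-- The isotropic coordinates of the listed algebras of index `(2, 1)`. -/
def isotropicCoords (i : F) : Entry F → IsotropicCoords F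
  | B1 => ⟨0, 0, 1, i, -i, 0⟩
  | B2 => ⟨0, 0, 1, 0, 2, 0⟩
  | B3 α => ⟨0, 0, α, i, -i, 1⟩
  | B4 => ⟨0, 0, 1, 0, 2, 1⟩
  | B5 α β => ⟨1, 1, 1, α + i * β, α - i * β, 0⟩
  | B6 α => ⟨1, 1, 0, α + i, α - i, 0⟩
  | B7 α β γ => ⟨1, 1, α, β + i * γ, β - i * γ, 1⟩
  | B8 α => ⟨0, 2, 1, α, α, 0⟩
  | B9plus => ⟨0, 2, 1, 0, 2, 0⟩
  | B9minus => ⟨0, 2, 1, 2, 0, 0⟩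
  | B10 => ⟨0, 2, 0, 1, 1, 0⟩
  | B11 => ⟨0, 2, 0, 2, 0, 0⟩
  | B12 α β => ⟨0, 2, 1, α + i * β, α - i * β, 1⟩
  | B13 α => ⟨0, 2, 0, α, α, 1⟩
  | B14 => ⟨0, 2, 0, 0, 2, 1⟩
  | B15 α => ⟨0, 2, 0, 2 * α, 0, 1⟩
  | _ => ⟨0, 0, 0, 0, 0, 0⟩

theorem ofMat_matrix (hi : i ^ 2 = -1) {m : Entry F} (hm : m.delta = [2, 1]) :
    IsotropicCoords.ofMat i (m.matrix i) = m.isotropicCoords i := by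
  cases m <;> simp [delta] at hm <;>
    ext <;> simp [IsotropicCoords.ofMat, isotropicCoords, matrix] <;> grind

end Entry

namespace IsotropicCoords

/-- Being equivalent to the coordinates of a listed algebra of index `(2, 1)`. -/
def IsListed (i : F) (X : IsotropicCoords F) : Prop :=
  ∃ m : Entry F, m.delta = [2, 1] ∧ m.SideCondition ∧
    (Rel X (m.isotropicCoords i) ∨ Rel X.swap (m.isotropicCoords i))

theorem IsListed.of_swap {X : IsotropicCoords F} (h : IsListed i X.swap) : IsListed i X := by
  obtain ⟨m, hm, hs, h⟩ := h
  exact ⟨m, hm, hs, h.symm⟩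

theorem isListed_of_rel {X : IsotropicCoords F} (m : Entry F) (hm : m.delta = [2, 1])
    (hs : m.SideCondition) {s t c : F} (hs0 : s ≠ 0) (ht0 : t ≠ 0) (hc0 : c ≠ 0)
    (h : X.P = t * (m.isotropicCoords i).P ∧ X.Q = s * (m.isotropicCoords i).Q ∧
      c * X.a = s * t * (m.isotropicCoords i).a ∧ s * X.R = c ^ 2 * (m.isotropicCoords i).R ∧
      t * X.S = c ^ 2 * (m.isotropicCoords i).S ∧ X.b = c * (m.isotropicCoords i).b) :
    IsListed i X :=
  ⟨m, hm, hs, .inl ⟨s, t, c, hs0, ht0, hc0, h⟩⟩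

variable [IsAlgClosed F] [CharZero F] (hi : i ^ 2 = -1) {X : IsotropicCoords F}
include hi

/-- Block type `O_2`. Here, as in the next lemmas, `s`, `t`, `c` come from solving the equations of
`Rel` for the target, and the parameters are what remains; `b ≠ 0` forces `c = b`. -/
theorem isListed_of_P_eq_zero_of_Q_eq_zero_of_S_ne_zero (hP : X.P = 0) (hQ : X.Q = 0)
    (ha : X.a ≠ 0) (hS : X.S ≠ 0) : IsListed i X := by
  obtain ⟨P, Q, a, R, S, b⟩ := X
  dsimp only at *
  subst hP hQ
  have hi0 : i ≠ 0 := by rintro rfl; norm_num at hi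
  by_cases hb : b = 0
  · subst hb
    by_cases hR : R = 0
    · subst hR
      refine isListed_of_rel .B2 rfl trivial (s := a * S / 2) (t := 2 / S) (c := 1) ?_ ?_ ?_ ?_ <;>
        simp [Entry.isotropicCoords] <;> grind
    -- The equations for `R` and `S` give `s` and `t` in terms of `c`; then `c a = s t` becomes `c³
    -- = a R S`.
    · obtain ⟨c, hc, hc3⟩ := exists_ne_zero_pow_eq (n := 3) (by norm_num) (a := a * R * S)
        (by positivity)
      refine isListed_of_rel .B1 rfl trivial (s := c ^ 2 * i / R) (t := -(c ^ 2 * i / S)) (c := c)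
        ?_ ?_ ?_ ?_ <;>
        simp [Entry.isotropicCoords] <;> grind
  · by_cases hR : R = 0
    · subst hR
      refine isListed_of_rel .B4 rfl trivial (s := a * S / (2 * b)) (t := 2 * b ^ 2 / S) (c := b)
        ?_ ?_ ?_ ?_ <;>
        simp [Entry.isotropicCoords] <;> grind
    · refine isListed_of_rel (.B3 (a * R * S / b ^ 3)) rfl trivial (s := b ^ 2 * i / R)
        (t := -(b ^ 2 * i / S)) (c := b) ?_ ?_ ?_ ?_ <;>
        simp [Entry.isotropicCoords] <;> grind

/-- Block type `E_2`: `P` and `Q` become 1 by `t = P`, `s = Q`. The scalar `c` is fixed by `b` or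
`a`; if both vanish, it is used to make the coefficient of `i` in `R` equal to 1. -/
theorem isListed_of_P_ne_zero_of_Q_ne_zero (hP : X.P ≠ 0) (hQ : X.Q ≠ 0)
    (h : X.a = 0 → X.b = 0 → X.Q * X.R - X.P * X.S ≠ 0) : IsListed i X := by
  obtain ⟨P, Q, a, R, S, b⟩ := X
  dsimp only at *
  have hi0 : i ≠ 0 := by rintro rfl; norm_num at hi
  by_cases hb : b = 0
  · subst hb
    by_cases ha : a = 0
    · subst ha
      obtain ⟨c, hc, hc2⟩ := exists_ne_zero_pow_eq (n := 2) (by norm_num)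
        (a := (Q * R - P * S) / (2 * i)) (div_ne_zero (h rfl rfl) (by simp [hi0]))
      rw [eq_div_iff (by simp [hi0])] at hc2
      refine isListed_of_rel (.B6 ((Q * R + P * S) / (2 * c ^ 2))) rfl trivial (s := Q) (t := P)
        (c := c) ?_ ?_ ?_ ?_ <;>
        simp [Entry.isotropicCoords] <;> grind
    · refine isListed_of_rel (.B5 ((Q * R + P * S) / (2 * (P * Q / a) ^ 2))
        ((Q * R - P * S) / (2 * i * (P * Q / a) ^ 2))) rfl trivial (s := Q) (t := P)
        (c := P * Q / a) ?_ ?_ ?_ ?_ <;>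
        simp [Entry.isotropicCoords] <;> grind
  · refine isListed_of_rel (.B7 (b * a / (P * Q)) ((Q * R + P * S) / (2 * b ^ 2))
      ((Q * R - P * S) / (2 * i * b ^ 2))) rfl trivial (s := Q) (t := P)
      (c := b) ?_ ?_ ?_ ?_ <;>
      simp [Entry.isotropicCoords] <;> grind

-- Block type `I_2` with `b = 0`: `s = Q / 2` is forced, while `t` and `c` are left to normalise
-- `a`, `R`, `S`.
omit hi in
theorem isListed_of_P_eq_zero_of_Q_ne_zero_of_b_eq_zero (hP : X.P = 0) (hQ : X.Q ≠ 0)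
    (hb : X.b = 0) (hRS : X.R = 0 → X.S ≠ 0) (h : X.a = 0 → X.R ≠ 0) : IsListed i X := by
  obtain ⟨P, Q, a, R, S, b⟩ := X
  dsimp only at *
  subst hP hb
  by_cases ha : a = 0
  · subst ha
    have hR := h rfl
    by_cases hS : S = 0
    · subst hS
      obtain ⟨c, hc, hc2⟩ := exists_ne_zero_pow_eq (n := 2) (by norm_num) (a := Q * R / 4)
        (div_ne_zero (mul_ne_zero hQ hR) (by norm_num))
      refine isListed_of_rel .B11 rfl trivial (s := Q / 2) (t := 1) (c := c) ?_ ?_ ?_ ?_ <;>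
        simp [Entry.isotropicCoords] <;> grind
    · obtain ⟨c, hc, hc2⟩ := exists_ne_zero_pow_eq (n := 2) (by norm_num) (a := Q * R / 2)
        (div_ne_zero (mul_ne_zero hQ hR) (by norm_num))
      refine isListed_of_rel .B10 rfl trivial (s := Q / 2) (t := c ^ 2 / S) (c := c)
        ?_ ?_ ?_ ?_ <;>
        simp [Entry.isotropicCoords] <;> grind
  · by_cases hR : R = 0
    · subst hR
      have hS := hRS rfl
      refine isListed_of_rel .B9plus rfl trivial (s := Q / 2) (t := 2 * (a * S / Q) * a / Q)
        (c := a * S / Q) ?_ ?_ ?_ ?_ <;>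
        simp [Entry.isotropicCoords] <;> grind
    · by_cases hS : S = 0
      · subst hS
        obtain ⟨c, hc, hc2⟩ := exists_ne_zero_pow_eq (n := 2) (by norm_num) (a := Q * R / 4)
          (div_ne_zero (mul_ne_zero hQ hR) (by norm_num))
        refine isListed_of_rel .B9minus rfl trivial (s := Q / 2) (t := 2 * c * a / Q) (c := c)
          ?_ ?_ ?_ ?_ <;>
          simp [Entry.isotropicCoords] <;> grind
      -- `t` equalises the two coordinates of `w`, that is `s R = t S`, and then `c = s t / a`.
      · refine isListed_of_rel (.B8 (8 * a ^ 2 * S ^ 2 / (Q ^ 3 * R))) rfl trivial (s := Q / 2)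
          (t := Q * R / (2 * S)) (c := Q ^ 2 * R / (4 * S * a)) ?_ ?_ ?_ ?_ <;>
          simp [Entry.isotropicCoords] <;> grind

-- Block type `I_2` with `b ≠ 0`: now `s = Q / 2` and `c = b` are forced. If `a ≠ 0`, so is `t`; if
-- `a = 0`, `t` acts on `S` alone, and the zeros among `R`, `S` decide the family.
omit [IsAlgClosed F] in
theorem isListed_of_P_eq_zero_of_Q_ne_zero_of_b_ne_zero (hP : X.P = 0) (hQ : X.Q ≠ 0)
    (hb : X.b ≠ 0) : IsListed i X := by
  obtain ⟨P, Q, a, R, S, b⟩ := X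
  dsimp only at *
  have hi0 : i ≠ 0 := by rintro rfl; norm_num at hi
  subst hP
  by_cases ha : a = 0
  · subst ha
    by_cases hS : S = 0
    · subst hS
      refine isListed_of_rel (.B15 (Q * R / (4 * b ^ 2))) rfl trivial (s := Q / 2) (t := 1) (c := b)
        ?_ ?_ ?_ ?_ <;>
        simp [Entry.isotropicCoords] <;> grind
    · by_cases hR : R = 0
      · subst hR
        refine isListed_of_rel .B14 rfl trivial (s := Q / 2) (t := 2 * b ^ 2 / S) (c := b)
          ?_ ?_ ?_ ?_ <;>
          simp [Entry.isotropicCoords] <;> grind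
      · have hα : Q * R / (2 * b ^ 2) ≠ 0 :=
          div_ne_zero (mul_ne_zero hQ hR) (by simpa using hb)
        refine isListed_of_rel (.B13 (Q * R / (2 * b ^ 2))) rfl hα (s := Q / 2)
          (t := Q * R / (2 * S)) (c := b) ?_ ?_ ?_ ?_ <;>
          simp [Entry.isotropicCoords] <;> grind
  · refine isListed_of_rel (.B12 ((Q * R / 2 + 2 * a * b * S / Q) / (2 * b ^ 2))
      ((Q * R / 2 - 2 * a * b * S / Q) / (2 * i * b ^ 2))) rfl trivial (s := Q / 2)
      (t := 2 * a * b / Q) (c := b) ?_ ?_ ?_ ?_ <;>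
      simp [Entry.isotropicCoords] <;> grind

theorem isListed_of_Q_ne_zero (hQ : X.Q ≠ 0) (hab : X.a = 0 → X.b = 0 → X.Q * X.R - X.P * X.S ≠ 0)
    (hw : X.b = 0 → X.R = 0 → X.S ≠ 0) : IsListed i X := by
  by_cases hP : X.P = 0
  · by_cases hb : X.b = 0
    · refine isListed_of_P_eq_zero_of_Q_ne_zero_of_b_eq_zero hP hQ hb (hw hb) fun ha hR => ?_
      exact hab ha hb (by rw [hP, hR]; ring)
    · exact isListed_of_P_eq_zero_of_Q_ne_zero_of_b_ne_zero hi hP hQ hb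
  · exact isListed_of_P_ne_zero_of_Q_ne_zero hi hP hQ hab

theorem isListed (hPQ : X.P = 0 → X.Q = 0 → X.a ≠ 0 ∧ (X.R ≠ 0 ∨ X.S ≠ 0))
    (hab : X.a = 0 → X.b = 0 → X.Q * X.R - X.P * X.S ≠ 0)
    (hw : X.b = 0 → X.R = 0 → X.S ≠ 0) : IsListed i X := by
  by_cases hQ : X.Q = 0
  · by_cases hP : X.P = 0
    · obtain ⟨ha, hR | hS⟩ := hPQ hP hQ
      · exact IsListed.of_swap
          (isListed_of_P_eq_zero_of_Q_eq_zero_of_S_ne_zero hi (X := X.swap) hQ hP ha hR)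
      · exact isListed_of_P_eq_zero_of_Q_eq_zero_of_S_ne_zero hi hP hQ ha hS
    · refine IsListed.of_swap (isListed_of_Q_ne_zero hi (X := X.swap) hP (fun ha hb h => ?_)
        fun hb hS hR => hw hb hR hS)
      exact hab ha hb (by simp only [swap] at h; linear_combination -h)
  · exact isListed_of_Q_ne_zero hi hQ hab hw

end IsotropicCoords

theorem eq_zero_of_isotropic [CharZero F] (hi : i ^ 2 = -1) {x y : F} (h1 : x + i * y = 0)
    (h2 : x - i * y = 0) : x = 0 ∧ y = 0 := by
  have hi0 : i ≠ 0 := by rintro rfl; norm_num at hi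
  have hx : x = 0 := by linear_combination (h1 + h2) / 2
  rw [hx, zero_add] at h1
  exact ⟨hx, (mul_eq_zero.1 h1).resolve_left hi0⟩

theorem eq_zero_of_linearIndependent_col {M : Matrix (Fin 3) (Fin 3) F}
    (h : LinearIndependent F ![M.col 0, M.col 2]) {s t : F} (h0 : s * M 0 0 + t * M 0 2 = 0)
    (h1 : s * M 1 0 + t * M 1 2 = 0) (h2 : s * M 2 0 + t * M 2 2 = 0) : s = 0 ∧ t = 0 := by
  refine LinearIndependent.pair_iff.1 h s t (funext fun k => ?_)
  revert k
  simpa [Fin.forall_fin_succ] using ⟨h0, h1, h2⟩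

variable [CharZero F] (hi : i ^ 2 = -1)
include hi

theorem isListed_ofMat [IsAlgClosed F] {M : Matrix (Fin 3) (Fin 3) F}
    (h : LinearIndependent F ![M.col 0, M.col 2]) :
    IsotropicCoords.IsListed i (IsotropicCoords.ofMat i M) := by
  have hi0 : i ≠ 0 := by rintro rfl; norm_num at hi
  have hLI := @eq_zero_of_linearIndependent_col _ _ _ h
  refine IsotropicCoords.isListed hi (fun hP hQ => ?_) (fun ha hb h0 => ?_) fun hb hR hS => ?_
  · obtain ⟨h0, h1⟩ := eq_zero_of_isotropic hi hP hQ
    have ha : M 2 0 ≠ 0 := fun ha => by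
      have := hLI (s := 1) (t := 0) (by simp [h0]) (by simp [h1]) (by simp [ha])
      simp at this
    refine ⟨ha, ?_⟩
    by_contra! H
    obtain ⟨h2, h3⟩ := eq_zero_of_isotropic hi H.1 H.2
    have := hLI (s := M 2 2) (t := -M 2 0) (by simp [h0, h2]) (by simp [h1, h3]) (by ring)
    exact ha (by simpa using this.2)
  · simp only [IsotropicCoords.ofMat] at ha hb h0
    -- `Q R - P S` is `2 i` times the determinant of the plane parts of the two columns.
    have hdet : M 0 0 * M 1 2 - M 1 0 * M 0 2 = 0 := by
      apply (mul_eq_zero.1 (?_ : 2 * i * (M 0 0 * M 1 2 - M 1 0 * M 0 2) = 0)).resolve_left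
        (by simp [hi0])
      linear_combination h0
    have h1 := hLI (s := M 0 2) (t := -M 0 0) (by ring) (by linear_combination -hdet)
      (by simp [ha, hb])
    have h2 := hLI (s := M 1 2) (t := -M 1 0) (by linear_combination hdet) (by ring)
      (by simp [ha, hb])
    have := hLI (s := 1) (t := 0) (by simpa using h1.2) (by simpa using h2.2) (by simp [ha])
    simp at this
  · obtain ⟨h0, h1⟩ := eq_zero_of_isotropic hi hR hS
    have hb' : M 2 2 = 0 := hb
    have := hLI (s := 0) (t := 1) (by simp [h0]) (by simp [h1]) (by simp [hb'])
    simp at this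

theorem exists_entry_of_hasDeltaIndex_two_one [IsAlgClosed F] {M : Matrix (Fin 3) (Fin 3) F}
    (hM : ∀ k, M k 1 = M k 0) (h : HasDeltaIndex (ofMatrix M) [2, 1]) :
    ∃ m : Entry F, m.delta = [2, 1] ∧ m.SideCondition ∧ Isomorphic (ofMatrix M) (m.product i) := by
  obtain ⟨m, hm, hs, hrel⟩ := isListed_ofMat hi (linearIndependent_of_hasDeltaIndex_two_one hM h)
  refine ⟨m, hm, hs, ?_⟩
  rw [← Entry.ofMat_matrix hi hm] at hrel
  exact IsotropicCoords.isomorphic_of_rel_or hi hM (Entry.matrix_one_eq_matrix_zero i hm) hrel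

namespace Entry

omit [CharZero F] in
theorem rel_or_of_isomorphic {m m' : Entry F} (hm : m.Admissible i) (hm' : m'.Admissible i)
    (hd : m.delta = [2, 1]) (hd' : m'.delta = [2, 1])
    (h : Isomorphic (m.product i) (m'.product i)) :
    IsotropicCoords.Rel (m.isotropicCoords i) (m'.isotropicCoords i) ∨
      IsotropicCoords.Rel (m.isotropicCoords i).swap (m'.isotropicCoords i) := by
  obtain ⟨φ, hφ⟩ := h
  have hM' := matrix_one_eq_matrix_zero i hd'
  have := IsotropicCoords.rel_or_of_isAlgIso (matrix_one_eq_matrix_zero i hd) hM' hi hm.1.2.1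
    (linearIndependent_of_hasDeltaIndex_two_one hM' (hd' ▸ hm'.1)) hφ
  rwa [ofMat_matrix hi hd, ofMat_matrix hi hd'] at this

theorem coincide_of_delta_eq_two_one {m m' : Entry F} (hm : m.Admissible i)
    (hm' : m'.Admissible i) (hd : m.delta = [2, 1]) (ht : m.trace = m'.trace)
    (h : Isomorphic (m.product i) (m'.product i)) : Coincide i m m' := by
  have hi0 : i ≠ 0 := by rintro rfl; norm_num at hi
  have hd' : m'.delta = [2, 1] := by rw [delta_eq_trace, ← ht, ← delta_eq_trace, hd]
  have hrel := rel_or_of_isomorphic hi hm hm' hd hd' h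
  have hs := hm.2
  have hs' := hm'.2
  have hn : ∀ k, m.matrix i 0 k = 0 → m.matrix i 1 k = 0 → m.matrix i 2 k ≠ 0 := by
    intro k h0 h1 h2
    refine isNondegenerate_ofMatrix_iff.1 hm.1.2.1 k ?_
    ext l
    fin_cases l <;> assumption
  have hn' : ∀ k, m'.matrix i 0 k = 0 → m'.matrix i 1 k = 0 → m'.matrix i 2 k ≠ 0 := by
    intro k h0 h1 h2
    refine isNondegenerate_ofMatrix_iff.1 hm'.1.2.1 k ?_
    ext l
    fin_cases l <;> assumption
  have hnz := hn 0
  have hn2 := hn 2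
  have hnz' := hn' 0
  have hn2' := hn' 2
  clear hm hm' h hn hn'
  cases m <;> simp [delta] at hd <;> cases m' <;> simp [trace] at ht
  case B1.B1 | B2.B2 | B4.B4 | B9plus.B9plus | B9minus.B9minus | B10.B10 | B11.B11 | B14.B14 =>
    exact .refl _
  all_goals
    rcases hrel with ⟨s, t, c, hs0, ht0, hc0, h1, h2, h3, h4, h5, h6⟩ |
      ⟨s, t, c, hs0, ht0, hc0, h1, h2, h3, h4, h5, h6⟩ <;>
    simp [isotropicCoords, IsotropicCoords.swap, matrix, SideCondition] at *
  case B3.B3.inl | B3.B3.inr | B6.B6.inl | B8.B8.inl | B13.B13.inl | B15.B15.inl =>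
    rename_i α α'
    obtain rfl : α = α' := by grind
    exact .refl _
  case B5.B5.inl | B12.B12.inl =>
    rename_i α β α' β'
    obtain rfl : α = α' := by grind
    obtain rfl : β = β' := by grind
    exact .refl _
  case B7.B7.inl =>
    rename_i α β γ α' β' γ'
    obtain rfl : α = α' := by grind
    obtain rfl : β = β' := by grind
    obtain rfl : γ = γ' := by grind
    exact .refl _
  -- `P = Q = 1` forces `s = t = 1`; the swap exchanges `R` and `S`, that is, changes the sign of `i
  -- β`.
  case B5.B5.inr =>
    rename_i α β α' β'
    obtain rfl : α = α' := by grind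
    obtain rfl : β' = -β := by grind
    exact .B5 _ _
  -- Here the coefficient of `i` is 1 on both sides, so the swap needs `c² = -1`, which changes the
  -- sign of `α`.
  case B6.B6.inr =>
    rename_i α α'
    obtain rfl : α' = -α := by grind
    exact .B6 _
  case B7.B7.inr =>
    rename_i α β γ α' β' γ'
    obtain rfl : α = α' := by grind
    obtain rfl : β = β' := by grind
    obtain rfl : γ' = -γ := by grind
    exact .B7 _ _ _
  -- What remains is impossible: swaps for type `I_2`, where `P = 0` and `Q = 2`, and pairs of
  -- different families, whose isotropic coordinates vanish in different places. Non-degeneracy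
  -- excludes zero columns, and `α ≠ 0` in `B13` keeps it apart from `B15`.
  all_goals
    exfalso
    grind

end Entry

end IndexTwoOneList

/-! ### Index `(3)`: reflections. -/

section IndexThree

variable {F : Type*} [Field F] {i : F}

theorem ofMatrix_apply_of_col_eq {n : ℕ} {M : Matrix (Fin n) (Fin n) F} {v : Fin n → F}
    (hM : ∀ k j, M k j = v k) (x y : Fin n → F) : ofMatrix M x y = (x ⬝ᵥ y) • v := by
  ext k
  simp [ofMatrix_apply, hM, dotProduct, Finset.mul_sum, mul_comm]

/-- Two algebras with `e_j² = v` and `e_j² = w` for all `j` are isomorphic through the reflection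
that exchanges `v` and `w`. -/
theorem isomorphic_of_reflection {n : ℕ} {M M' : Matrix (Fin n) (Fin n) F} {v w : Fin n → F}
    (hM : ∀ k j, M k j = v k) (hM' : ∀ k j, M' k j = w k) (hvw : v ⬝ᵥ v = w ⬝ᵥ w)
    (hne : v ⬝ᵥ w ≠ v ⬝ᵥ v) : Isomorphic (ofMatrix M) (ofMatrix M') := by
  set d := v ⬝ᵥ v - v ⬝ᵥ w with hd
  have hd0 : d ≠ 0 := sub_ne_zero.2 hne.symm
  obtain ⟨u, hu⟩ : ∃ u, u = v - w := ⟨_, rfl⟩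
  have huu : u ⬝ᵥ u = 2 * d := by
    rw [hu, dotProduct_sub, sub_dotProduct, sub_dotProduct, ← hvw, dotProduct_comm w v]
    ring
  -- The orthogonal reflection `x - 2 (x·u / u·u) u` with `u = v - w`, since `u · u = 2 d`.
  let f : (Fin n → F) →ₗ[F] (Fin n → F) :=
    { toFun := fun x => x - (x ⬝ᵥ u / d) • u
      map_add' := fun x y => by rw [add_dotProduct, add_div, add_smul]; abel
      map_smul' := fun c x => by
        rw [smul_dotProduct, smul_eq_mul, mul_div_assoc, mul_smul, RingHom.id_apply, smul_sub] }
  have hf : ∀ x, f x = x - (x ⬝ᵥ u / d) • u := fun _ => rfl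
  have hinv : Function.Involutive f := by
    intro x
    rw [hf, hf, sub_dotProduct, smul_dotProduct, huu, smul_eq_mul, sub_sub, ← add_smul]
    have : x ⬝ᵥ u / d + (x ⬝ᵥ u - x ⬝ᵥ u / d * (2 * d)) / d = 0 := by
      field_simp; ring
    rw [this, zero_smul, sub_zero]
  have hfv : f v = w := by
    have : v ⬝ᵥ u = d := by rw [hu, dotProduct_sub]
    rw [hf, this, div_self hd0, one_smul, hu, sub_sub_cancel]
  refine ⟨LinearEquiv.ofInvolutive f hinv, fun x y => ?_⟩
  rw [ofMatrix_apply_of_col_eq hM, ofMatrix_apply_of_col_eq hM', map_smul]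
  change (x ⬝ᵥ y) • f v = (f x ⬝ᵥ f y) • w
  rw [hfv]
  congr 1
  rw [hf, hf, sub_dotProduct, dotProduct_sub, dotProduct_sub, smul_dotProduct, smul_dotProduct,
    dotProduct_smul, dotProduct_smul, huu, dotProduct_comm u y]
  simp only [smul_eq_mul]
  field_simp
  ring

variable {M : Matrix (Fin 3) (Fin 3) F}

theorem E3_col (k j : Fin 3) :
    (Entry.E3 : Entry F).matrix i k j = (Pi.single 0 1 : Fin 3 → F) k := by
  fin_cases k <;> fin_cases j <;> rfl

theorem isomorphic_scale_const {n : ℕ} {M M' : Matrix (Fin n) (Fin n) F} {c : F} (hc : c ≠ 0)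
    (h : ∀ k j, M k j = c * M' k j) : Isomorphic (ofMatrix M) (ofMatrix M') :=
  isomorphic_of_perm (Equiv.refl _) (x := fun _ => c) (fun _ => hc) fun k j => by
    rw [h]; simp only [Equiv.refl_apply]; ring

/-- The reflection from `v` to `e_1` breaks down when `v 0 = 1`, because `v - e_1` is then
isotropic. In that case `v` is reflected to `-e_1` and the basis is scaled by `-1`. -/
theorem isomorphic_E3_of_sq_eq_one [CharZero F] {v : Fin 3 → F} (hM : ∀ k j, M k j = v k)
    (hv : v ⬝ᵥ v = 1) : Isomorphic (ofMatrix M) (Entry.E3.product i) := by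
  by_cases h0 : v 0 = 1
  · have h1 : Isomorphic (ofMatrix M)
        (ofMatrix (Matrix.of fun k _ => -(Pi.single 0 1 : Fin 3 → F) k)) := by
      refine isomorphic_of_reflection hM (w := -Pi.single 0 1) (fun _ _ => rfl) ?_ ?_
      · simp [hv]
      · rw [hv]
        simp [h0]
        norm_num
    refine h1.trans (isomorphic_scale_const (c := -1) (by simp) fun k j => ?_)
    rw [E3_col]
    simp
  · refine isomorphic_of_reflection hM (fun k j => E3_col k j) ?_ ?_
    · simp [hv]
    · simpa [hv] using h0

theorem isomorphic_E3 [IsAlgClosed F] [CharZero F] {v : Fin 3 → F} (hM : ∀ k j, M k j = v k)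
    (hv : v ⬝ᵥ v ≠ 0) : Isomorphic (ofMatrix M) (Entry.E3.product i) := by
  obtain ⟨c, hc, hc2⟩ := exists_ne_zero_pow_eq (n := 2) (by norm_num) hv
  refine (isomorphic_scale_const (M' := Matrix.of fun k _ => c⁻¹ * v k) hc fun k j => ?_).trans
    (isomorphic_E3_of_sq_eq_one (v := c⁻¹ • v) (fun _ _ => rfl) ?_)
  · simp [hM, hc]
  · rw [smul_dotProduct, dotProduct_smul, ← hc2]
    simp only [smul_eq_mul]
    field_simp

theorem isomorphic_I3_of_ne_zero (hi : i ^ 2 = -1) {v : Fin 3 → F} (hM : ∀ k j, M k j = v k)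
    (hv : v ⬝ᵥ v = 0) (h0 : v 0 + i * v 1 ≠ 0) : Isomorphic (ofMatrix M) (Entry.I3.product i) := by
  refine isomorphic_of_reflection hM (w := ![1, i, 0])
    (fun k j => by fin_cases k <;> fin_cases j <;> rfl) ?_ ?_
  · rw [hv]
    simp [dotProduct, Fin.sum_univ_three]
    linear_combination -hi
  · rw [hv]
    simpa [dotProduct, Fin.sum_univ_three, mul_comm] using h0

/-- The reflection to `(1, i, 0)` needs `v 0 + i v 1 ≠ 0`. If this fails, the sign change of `e_2`
helps: both combinations `v 0 ± i v 1` vanish only for `v 0 = v 1 = 0`, and then an isotropic `v` is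
zero. -/
theorem isomorphic_I3 [CharZero F] (hi : i ^ 2 = -1) {v : Fin 3 → F} (hM : ∀ k j, M k j = v k)
    (hv : v ⬝ᵥ v = 0) (h0 : v ≠ 0) : Isomorphic (ofMatrix M) (Entry.I3.product i) := by
  by_cases h1 : v 0 + i * v 1 = 0
  · have h2 : v 0 - i * v 1 ≠ 0 := by
      intro h2
      obtain ⟨h3, h4⟩ := eq_zero_of_isotropic hi h1 h2
      refine h0 (funext fun k => ?_)
      simp [dotProduct, Fin.sum_univ_three, h3, h4] at hv
      fin_cases k <;> simp [h3, h4, hv]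
    have hx : ∀ j, (![1, -1, 1] : Fin 3 → F) j ≠ 0 := by
      intro j; fin_cases j <;> simp
    refine (isomorphic_scale M hx).trans (isomorphic_I3_of_ne_zero hi (v := ![v 0, -v 1, v 2])
      (fun k j => ?_) ?_ ?_)
    · fin_cases k <;> fin_cases j <;> simp [hM]
    · rw [← hv]
      simp [dotProduct, Fin.sum_univ_three]
    · simpa [sub_eq_add_neg] using h2
  · exact isomorphic_I3_of_ne_zero hi hM hv h1

theorem exists_entry_of_hasDeltaIndex_three [IsAlgClosed F] [CharZero F] (hi : i ^ 2 = -1)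
    (hM : ∀ k j, M k j = M k 0) (h : IsNondegenerate (ofMatrix M)) :
    ∃ m : Entry F, m.delta = [3] ∧ m.SideCondition ∧ Isomorphic (ofMatrix M) (m.product i) := by
  by_cases hv : M.col 0 ⬝ᵥ M.col 0 = 0
  · exact ⟨.I3, rfl, trivial, isomorphic_I3 hi hM hv (isNondegenerate_ofMatrix_iff.1 h 0)⟩
  · exact ⟨.E3, rfl, trivial, isomorphic_E3 hM hv⟩

end IndexThree

/-! ### Assembling the classification. -/

section Classification

variable {F V : Type*} [Field F] [AddCommGroup V] [Module F V]

theorem exists_isomorphic_ofMatrix {μ : V →ₗ[F] V →ₗ[F] V} {n : ℕ} (hn : Module.finrank F V = n)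
    (h : IsEvolutionAlgebra μ) :
    ∃ M : Matrix (Fin n) (Fin n) F, Isomorphic μ (ofMatrix M) := by
  subst hn
  obtain ⟨b, hb⟩ := h
  refine ⟨Matrix.of fun k j => b.repr (μ (b j) (b j)) k, b.equivFun, fun x y => ?_⟩
  have : μ.compr₂ b.equivFun.toLinearMap =
      (ofMatrix (Matrix.of fun k j => b.repr (μ (b j) (b j)) k)).compl₁₂
        b.equivFun.toLinearMap b.equivFun.toLinearMap := by
    refine b.ext fun j => b.ext fun l => ?_
    have hs : ∀ j, b.equivFun (b j) = Pi.single j 1 := fun j => by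
      ext k; simp [Pi.single_apply, eq_comm]
    simp only [LinearMap.compr₂_apply, LinearMap.compl₁₂_apply, LinearEquiv.coe_coe, hs]
    by_cases hjl : j = l
    · subst hjl
      rw [ofMatrix_single_single]
      rfl
    · rw [hb j l hjl, map_zero, ofMatrix_apply_single, Pi.single_eq_of_ne (Ne.symm hjl), zero_smul]
  exact LinearMap.congr_fun₂ this x y

variable [IsAlgClosed F] [CharZero F] {i : F} (hi : i ^ 2 = -1)
include hi

theorem exists_entry_of_isNondegenerate {M : Matrix (Fin 3) (Fin 3) F}
    (hN : IsNondegenerate (ofMatrix M)) :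
    ∃ m : Entry F, m.Admissible i ∧ Isomorphic (ofMatrix M) (m.product i) := by
  have hcol := isNondegenerate_ofMatrix_iff.1 hN
  by_cases h : ∀ j l, j ≠ l → LinearIndependent F ![M.col j, M.col l]
  · have hd := hasDeltaIndex_one_one_one h
    obtain ⟨m, hm, hiso⟩ := hasNormalForm_of_hasDeltaIndex i hd
    refine ⟨m, ⟨hm ▸ hd.of_isomorphic hiso, ?_⟩, hiso⟩
    cases m <;> simp [Entry.delta] at hm <;> trivial
  push Not at h
  obtain ⟨j, l, hjl, h⟩ := h
  rw [LinearIndependent.pair_iff' (hcol j)] at h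
  push Not at h
  obtain ⟨a, ha⟩ := h
  have ha0 : a ≠ 0 := by
    rintro rfl
    exact hcol l (by rw [← ha, zero_smul])
  -- Scaling a basis vector by `y` divides its own column by `y² = a`, which makes the two
  -- proportional columns equal; the row `l` it also rescales is rescaled in both.
  obtain ⟨y, hy, hy2⟩ := exists_ne_zero_pow_eq (n := 2) (by norm_num) ha0
  obtain ⟨σ, rfl, rfl⟩ : ∃ σ : Equiv.Perm (Fin 3), σ 0 = j ∧ σ 1 = l := by
    clear ha
    revert j l
    decide
  obtain ⟨N, hMN, hN1⟩ : ∃ N : Matrix (Fin 3) (Fin 3) F, Isomorphic (ofMatrix M) (ofMatrix N) ∧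
      ∀ k, N k 1 = N k 0 := by
    have hx : ∀ j, (![1, y, 1] : Fin 3 → F) j ≠ 0 := by
      intro j; fin_cases j <;> simp [hy]
    refine ⟨_, (isomorphic_submatrix M σ).trans (isomorphic_scale _ hx), fun k => ?_⟩
    have := congrFun ha (σ k)
    simp at this
    simp [← this, hy2]
    field_simp
  suffices ∃ m : Entry F, m.Admissible i ∧ Isomorphic (ofMatrix N) (m.product i) from
    this.imp fun _ h => ⟨h.1, hMN.trans h.2⟩
  obtain ⟨φ, hφ⟩ := hMN
  have hNN := hφ.isNondegenerate hN
  have hcolN := isNondegenerate_ofMatrix_iff.1 hNN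
  by_cases h : LinearIndependent F ![N.col 0, N.col 2]
  · have hd := hasDeltaIndex_two_one hN1 h
    obtain ⟨m, hm, hs, hiso⟩ := exists_entry_of_hasDeltaIndex_two_one hi hN1 hd
    exact ⟨m, ⟨hm ▸ hd.of_isomorphic hiso, hs⟩, hiso⟩
  rw [LinearIndependent.pair_iff' (hcolN 0)] at h
  push Not at h
  obtain ⟨b, hb⟩ := h
  have hb0 : b ≠ 0 := by
    rintro rfl
    exact hcolN 2 (by rw [← hb, zero_smul])
  obtain ⟨z, hz, hz2⟩ := exists_ne_zero_pow_eq (n := 2) (by norm_num) hb0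
  obtain ⟨L, hNL, hL⟩ : ∃ L : Matrix (Fin 3) (Fin 3) F, Isomorphic (ofMatrix N) (ofMatrix L) ∧
      ∀ k j, L k j = L k 0 := by
    have hx : ∀ j, (![1, 1, z] : Fin 3 → F) j ≠ 0 := by
      intro j; fin_cases j <;> simp [hz]
    refine ⟨_, isomorphic_scale _ hx, fun k j => ?_⟩
    have := congrFun hb k
    simp at this
    fin_cases j <;> simp [← this, hz2, hN1]
    field_simp
  suffices ∃ m : Entry F, m.Admissible i ∧ Isomorphic (ofMatrix L) (m.product i) from
    this.imp fun _ h => ⟨h.1, hNL.trans h.2⟩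
  obtain ⟨ψ, hψ⟩ := hNL
  have hNL := hψ.isNondegenerate hNN
  obtain ⟨m, hm, hs, hiso⟩ := exists_entry_of_hasDeltaIndex_three hi hL hNL
  have hd := hasDeltaIndex_three hL (isNondegenerate_ofMatrix_iff.1 hNL 0)
  exact ⟨m, ⟨hm ▸ hd.of_isomorphic hiso, hs⟩, hiso⟩

-- The traces agree by invariance, so only families of equal trace have to be compared; for index
-- `(3)` the trace determines the entry.
omit [IsAlgClosed F] in
theorem coincide_of_isomorphic {m m' : Entry F} (hm : m.Admissible i) (hm' : m'.Admissible i)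
    (h : Isomorphic (m.product i) (m'.product i)) : Coincide i m m' := by
  have ht : m.trace = m'.trace :=
    (hm.hasDeltaTrace.of_isomorphic h).unique hi hm'.hasDeltaTrace
  have : m.delta = [1, 1, 1] ∨ m.delta = [2, 1] ∨ m.delta = [3] := by
    cases m <;> simp [Entry.delta]
  rcases this with hd | hd | hd
  · exact Entry.coincide_of_delta_eq_one_one_one hm hm' hd ht h
  · exact Entry.coincide_of_delta_eq_two_one hi hm hm' hd ht h
  · have : m = m' := by
      cases m <;> simp [Entry.delta] at hd <;> cases m' <;> simp [Entry.trace] at ht ⊢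
    exact this ▸ .refl m

omit [IsAlgClosed F] [CharZero F] in
theorem Coincide.isomorphic {m m' : Entry F} (h : Coincide i m m') :
    Isomorphic (m.product i) (m'.product i) := by
  cases h with
  | refl => exact .refl _
  | A1 _ _ _ _ _ _ h => exact h.isomorphic
  | A2 _ _ h => exact h.isomorphic
  | A3 _ _ _ _ _ _ _ _ h => exact h.isomorphic
  | A4 _ _ _ _ _ _ h => exact h.isomorphic
  | A5 _ _ _ _ h => exact h.isomorphic
  | A6 _ _ _ _ _ _ _ _ _ _ h => exact h.isomorphic
  | A7 _ _ _ _ _ _ _ _ _ _ _ _ h => exact h.isomorphic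
  | B5 α β =>
    refine isomorphic_of_perm (Equiv.refl _) (x := ![1, -1, 1])
      (fun j => by fin_cases j <;> simp) fun k j => ?_
    fin_cases k <;> fin_cases j <;> simp [Entry.matrix]
  | B6 α =>
    have hi0 : i ≠ 0 := by rintro rfl; simp at hi
    -- Scaling `e_3` by `i` divides its column by `-1`, which compensates the sign on `e_2` and
    -- changes that of `α`.
    refine isomorphic_of_perm (Equiv.refl _) (x := ![1, -1, i])
      (fun j => by fin_cases j <;> simp [hi0]) fun k j => ?_
    fin_cases k <;> fin_cases j <;> simp [Entry.matrix, hi]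
  | B7 α β γ =>
    refine isomorphic_of_perm (Equiv.refl _) (x := ![1, -1, 1])
      (fun j => by fin_cases j <;> simp) fun k j => ?_
    fin_cases k <;> fin_cases j <;> simp [Entry.matrix]

end Classification
end EvolutionAlgebra

open EvolutionAlgebra
theorem mainTheorem3 {F : Type*} [Field F] [IsAlgClosed F] [CharZero F]
    (i : F) (hi : i ^ 2 = -1) :
    -- every algebra has exactly one index and one trace, and is isomorphic to an algebra listed
    -- under them; two algebras of the list isomorphic to it are among the stated coincidences
    (∀ (A : Type*) [NonUnitalNonAssocRing A] [Module F A] [IsScalarTower F A A]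
        [SMulCommClass F A A],
      Module.finrank F A = 3 → IsEvolutionAlgebra (LinearMap.mul F A) →
      IsNondegenerate (LinearMap.mul F A) →
      ∃ (d : List ℕ) (t : List Block),
        (∀ d', HasDeltaIndex (LinearMap.mul F A) d' ↔ d' = d) ∧
        (∀ t', HasDeltaTrace i (LinearMap.mul F A) t' ↔ t' = t) ∧
        (∃ m : Entry F, m.Admissible i ∧ m.delta = d ∧ m.trace = t ∧
          Isomorphic (LinearMap.mul F A) (m.product i)) ∧
        (∀ m m' : Entry F, m.Admissible i → m'.Admissible i →
          Isomorphic (LinearMap.mul F A) (m.product i) →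
          Isomorphic (LinearMap.mul F A) (m'.product i) → Coincide i m m')) ∧
    -- the algebras of the list have the trace under which they are listed
    (∀ m : Entry F, m.Admissible i → HasDeltaTrace i (m.product i) m.trace) ∧
    -- the isomorphisms inside the list
    (∀ m m' : Entry F, m.Admissible i → m'.Admissible i →
      (Isomorphic (m.product i) (m'.product i) ↔ Coincide i m m')) ∧
    -- for index `(1, 1, 1)` every isomorphism is a permutation of the basis, up to scalars on
    -- the vectors whose square has no component along themselves
    (∀ m m' : Entry F, m.Admissible i → m'.Admissible i →
      m.delta = [1, 1, 1] → m'.delta = [1, 1, 1] →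
      ∀ φ : (Fin 3 → F) ≃ₗ[F] (Fin 3 → F), IsAlgIso (m.product i) (m'.product i) φ →
        ∃ (σ : Equiv.Perm (Fin 3)) (x : Fin 3 → F), (∀ j, x j ≠ 0) ∧
          (∀ j, m.matrix i j j = 1 → x j = 1) ∧
          ∀ j, φ (Pi.single j 1) = x j • Pi.single (σ j) 1) := by
  refine ⟨fun A _ _ _ _ hA hE hN => ?_, fun m hm => hm.hasDeltaTrace,
    fun m m' hm hm' => ⟨coincide_of_isomorphic hi hm hm', Coincide.isomorphic hi⟩,
    fun m m' _ hm' _ hd' φ hφ => ?_⟩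
  · obtain ⟨M, φ, hφ⟩ := exists_isomorphic_ofMatrix hA hE
    obtain ⟨m, hm, hiso⟩ := exists_entry_of_isNondegenerate hi (hφ.isNondegenerate hN)
    replace hiso := Isomorphic.trans ⟨φ, hφ⟩ hiso
    have hd := hm.1.of_isomorphic hiso.symm
    have ht := hm.hasDeltaTrace.of_isomorphic hiso.symm
    exact ⟨m.delta, m.trace, fun d' => ⟨fun h => h.unique hd, fun h => h ▸ hd⟩,
      fun t' => ⟨fun h => h.unique hi ht, fun h => h ▸ ht⟩, ⟨m, hm, rfl, rfl, hiso⟩,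
      fun m₁ m₂ h₁ h₂ hi₁ hi₂ => coincide_of_isomorphic hi h₁ h₂ (hi₁.symm.trans hi₂)⟩
  · obtain ⟨σ, x, hx, hx1, hφx, -⟩ := Entry.exists_perm_of_isAlgIso hm' hd' hφ
    exact ⟨σ, x, hx, hx1, hφx⟩
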